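/- Let $E\subseteq\mathbb R^n\times\mathbb R^m$ be an open coordinate patch with coordinates $(x^\mu,\phi^i)$, and let $J^\infty(E)$ be its infinite jet space, with coordinates $x^\mu,\phi^i,\phi^i_{\mu_1},\phi^i_{\mu_1\mu_2},\dots$ (symmetric in the lower indices). A local function is a smooth function of finitely many of these coordinates. Forms on $J^\infty(E)$ have local coefficients and are generated by the anticommuting $dx^\mu$ and $\mathrm d_V\phi^i_{\mu_1\dots\mu_k}$; $\partial/\partial dx^\nu$ and $\partial^S/\partial \mathrm d_V\phi^i_{(\mu)}$ are left derivatives. Here $(\mu)=(\mu_1,\dots,\mu_k)$ denotes a tuple of any length $|\mu|=k\ge 0$, repeated indices and repeated tuples are summed over, and $\partial^S/\partial\phi^i_{(\mu)}$ is the symmetrized derivative, $\partial^S\phi^j_{\nu_1\dots\nu_k}/\partial\phi^i_{\mu_1\dots\mu_k}=\delta^j_i\,\delta^{\mu_1}_{(\nu_1}\cdots\delta^{\mu_k}_{\nu_k)}$ (symmetrization of weight one), which vanishes on $x^\mu$ and on derivatives of another order; the convention for $\partial^S/\partial \mathrm d_V\phi^i_{(\mu)}$ is the same. The total derivatives are $$\partial_\nu=\frac{\partial}{\partial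 x^\nu}+\phi^i_{\nu(\mu)}\frac{\partial^S}{\partial\phi^i_{(\mu)}}+\mathrm d_V\phi^i_{\nu(\mu)}\frac{\partial^S}{\partial \mathrm d_V\phi^i_{(\mu)}},\qquad \partial_{(\mu)}=\partial_{\mu_1}\cdots\partial_{\mu_k},\qquad (-\partial)_{(\mu)}=(-1)^{|\mu|}\partial_{(\mu)}.$$ The higher Euler--Lagrange derivatives are $$\frac{\delta\omega}{\delta\phi^i_{(\mu)}}=\binom{|\mu|+|\rho|}{|\mu|}(-\partial)_{(\rho)}\frac{\partial^S\omega}{\partial\phi^i_{((\mu)(\rho))}},$$ with $\delta\omega/\delta\phi^i$ the case $|\mu|=0$. For a horizontal $n$-form $\omega^n$ (a form of type $(n,0)$) and tuples $Q=(Q^i)$, $Q_1$, $Q_2$ of local functions put $$I^n_{\mathrm d_V\phi}\,\alpha=\partial_{(\mu)}\Big(\mathrm d_V\phi^i\,\frac{\delta}{\delta\phi^i_{((\mu)\nu)}}\frac{\partial\alpha}{\partial dx^\nu}\Big),\qquad I^n_{Q}\,\alpha=\partial_{(\mu)}\Big(Q^i\,\frac{\delta}{\delta\phi^i_{((\mu)\nu)}}\frac{\partial\alpha}{\partial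 dx^\nu}\Big),\qquad i_Q\,\alpha=\partial_{(\mu)}Q^i\,\frac{\partial^S\alpha}{\partial \mathrm d_V\phi^i_{(\mu)}},$$ $$T_{Q_1}\Big[Q_2,\frac{\delta\omega^n}{\delta\phi}\Big]=\binom{|\mu|+|\rho|+1}{|\mu|+1}\,\partial_{(\mu)}\Big(Q_2^i\,(-\partial)_{(\rho)}\Big(\frac{\partial^SQ_1^j}{\partial\phi^i_{((\mu)(\rho)\nu)}}\frac{\partial}{\partial dx^\nu}\frac{\delta\omega^n}{\delta\phi^j}\Big)\Big).$$ The invariant presymplectic $(n-1,2)$-form of $\omega^n$ is $$W_{\delta\omega^n/\delta\phi}=-\tfrac12\,I^n_{\mathrm d_V\phi}\Big(\mathrm d_V\phi^i\,\frac{\delta\omega^n}{\delta\phi^i}\Big),\qquad\text{and}\qquad W_{\delta\omega^n/\delta\phi}[Q_1,Q_2]=i_{Q_2}i_{Q_1}W_{\delta\omega^n/\delta\phi}.$$ **Proposition.** For every horizontal $n$-form $\omega^n$ with local coefficients and all tuples $Q_1=(Q_1^i)$, $Q_2=(Q_2^i)$ of local functions, $$W_{\delta\omega^n/\delta\phi}[Q_1,Q_2]=I^n_{Q_1}\Big(Q_2^i\frac{\delta\omega^n}{\delta\phi^i}\Big)-T_{Q_2}\Big[Q_1,\frac{\delta\omega^n}{\delta\phi}\Big]$$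 $$=\binom{|\mu|+|\rho|+1}{|\mu|+1}\,\partial_{(\mu)}\Big(Q_1^i\,(-\partial)_{(\rho)}\Big(Q_2^j\,\frac{\partial^S}{\partial\phi^i_{((\mu)(\rho)\nu)}}\frac{\partial}{\partial dx^\nu}\frac{\delta\omega^n}{\delta\phi^j}\Big)\Big).$$ -/

import Mathlib

open scoped TensorProduct Topology

noncomputable section

namespace VarBicomplex

/-- Labels of the coordinates of the infinite jet space over `ℝⁿ` with fields indexed by `ι`:
`Sum.inl μ` labels `x^μ`, and `Sum.inr (i, s)` labels the derivative `φ^i_{μ₁…μ_k}`, where `s` is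
the multiset `{μ₁, …, μ_k}` (derivatives are symmetric in their indices). -/
abbrev Coord (n : ℕ) (ι : Type*) := Fin n ⊕ (ι × Multiset (Fin n))

variable {n : ℕ} {ι : Type*}

/-- The point `(x^μ, φ^i)` of the total space below a jet. -/
def base (J : Coord n ι → ℝ) : (Fin n → ℝ) × (ι → ℝ) :=
  (fun μ => J (Sum.inl μ), fun i => J (Sum.inr (i, 0)))

/-- The infinite jet space over an open coordinate patch `E ⊆ ℝⁿ × ℝ^ι`: the derivatives of
positive order are unconstrained. -/
abbrev Jet (E : TopologicalSpace.Opens ((Fin n → ℝ) × (ι → ℝ))) :=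
  {J : Coord n ι → ℝ // base J ∈ E}

/-- The values of finitely many coordinates of a jet. -/
def restr (E : TopologicalSpace.Opens ((Fin n → ℝ) × (ι → ℝ))) (S : Finset (Coord n ι))
    (J : Jet E) : S → ℝ := fun c => J.1 c

/-- A function on the jet space is local if it is a smooth function of finitely many
coordinates. -/
def IsLocal (E : TopologicalSpace.Opens ((Fin n → ℝ) × (ι → ℝ))) (f : Jet E → ℝ) : Prop :=
  ∃ (S : Finset (Coord n ι)) (g : (S → ℝ) → ℝ),
    ContDiffOn ℝ ((⊤ : ℕ∞) : WithTop ℕ∞) g (Set.range (restr E S)) ∧ ∀ J, f J = g (restr E S J)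

variable {E : TopologicalSpace.Opens ((Fin n → ℝ) × (ι → ℝ))}

theorem continuous_base : Continuous (base : (Coord n ι → ℝ) → _) := by
  unfold base; fun_prop

theorem isOpen_range_restr (S : Finset (Coord n ι)) : IsOpen (Set.range (restr E S)) := by
  classical
  rw [isOpen_iff_mem_nhds]
  rintro _ ⟨J, rfl⟩
  let e : (S → ℝ) → (Coord n ι → ℝ) := fun q c => if h : c ∈ S then q ⟨c, h⟩ else J.1 c
  have he : Continuous e := by
    refine continuous_pi fun c => ?_
    by_cases h : c ∈ S
    · simp only [e, h, dif_pos]; fun_prop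
    · simp only [e, h, dif_neg, not_false_eq_true]; exact continuous_const
  have heJ : e (restr E S J) = J.1 := by
    funext c
    by_cases h : c ∈ S <;> simp [e, h, restr]
  have hopen : IsOpen {q : S → ℝ | base (e q) ∈ E} :=
    E.isOpen.preimage (continuous_base.comp he)
  refine Filter.mem_of_superset (hopen.mem_nhds (by simp [heJ, J.2])) ?_
  intro q hq
  refine ⟨⟨e q, hq⟩, ?_⟩
  funext c
  simp [restr, e]

/-- Local data may be transported to a larger finite set of coordinates. -/
theorem IsLocal.enlarge {S T : Finset (Coord n ι)} (h : S ⊆ T) {g : (S → ℝ) → ℝ}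
    (hg : ContDiffOn ℝ ((⊤ : ℕ∞) : WithTop ℕ∞) g (Set.range (restr E S))) :
    ContDiffOn ℝ ((⊤ : ℕ∞) : WithTop ℕ∞) (fun q : T → ℝ => g (fun c => q ⟨c, h c.2⟩)) (Set.range (restr E T)) := by
  refine hg.comp (t := Set.range (restr E S)) (f := fun (q : T → ℝ) (c : S) => q ⟨c, h c.2⟩) ?_ ?_
  · exact (contDiff_pi.2 fun c => contDiff_apply _ _ _).contDiffOn
  · rintro _ ⟨J, rfl⟩
    exact ⟨J, rfl⟩

/-- The algebra of local functions. -/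
def Loc (E : TopologicalSpace.Opens ((Fin n → ℝ) × (ι → ℝ))) : Subalgebra ℝ (Jet E → ℝ) where
  carrier := {f | IsLocal E f}
  mul_mem' := by
    classical
    rintro f₁ f₂ ⟨S, g, hg, hf⟩ ⟨T, k, hk, hf'⟩
    exact ⟨S ∪ T, _, (IsLocal.enlarge Finset.subset_union_left hg).mul
      (IsLocal.enlarge Finset.subset_union_right hk), fun J => by simp [hf, hf']; rfl⟩
  add_mem' := by
    classical
    rintro f₁ f₂ ⟨S, g, hg, hf⟩ ⟨T, k, hk, hf'⟩
    exact ⟨S ∪ T, _, (IsLocal.enlarge Finset.subset_union_left hg).add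
      (IsLocal.enlarge Finset.subset_union_right hk), fun J => by simp [hf, hf']; rfl⟩
  algebraMap_mem' r := ⟨∅, fun _ => r, contDiffOn_const, fun _ => rfl⟩

/-- A coordinate of the jet space as a local function. -/
def coord (c : Coord n ι) : Loc E :=
  ⟨fun J => J.1 c, {c}, fun q => q ⟨c, by simp⟩, (contDiff_apply _ _ _).contDiffOn,
    fun _ => rfl⟩

open Classical in
/-- The function of `t` obtained from `f` by replacing the coordinate `c` of `J` by `t`
(extended by zero where the resulting jet leaves the patch). -/
def slice (c : Coord n ι) (f : Jet E → ℝ) (J : Jet E) (t : ℝ) : ℝ :=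
  if h : base (Function.update J.1 c t) ∈ E then f ⟨Function.update J.1 c t, h⟩ else 0

open Classical in
theorem hasDerivAt_slice (c : Coord n ι) {f : Jet E → ℝ} {S : Finset (Coord n ι)}
    {g : (S → ℝ) → ℝ} (hg : ContDiffOn ℝ ((⊤ : ℕ∞) : WithTop ℕ∞) g (Set.range (restr E S)))
    (hf : ∀ J, f J = g (restr E S J)) (J : Jet E) :
    HasDerivAt (slice c f J)
      (fderiv ℝ g (restr E S J) (fun s => if (s : Coord n ι) = c then 1 else 0)) (J.1 c) := by
  have hmem : Set.range (restr E S) ∈ 𝓝 (restr E S J) :=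
    (isOpen_range_restr S).mem_nhds ⟨J, rfl⟩
  have hgd : HasFDerivAt g (fderiv ℝ g (restr E S J)) (restr E S J) :=
    ((hg.contDiffAt hmem).differentiableAt (by simp)).hasFDerivAt
  let γ : ℝ → (S → ℝ) := fun t s => Function.update J.1 c t s
  have hγ : HasDerivAt γ (fun s => if (s : Coord n ι) = c then 1 else 0) (J.1 c) := by
    refine hasDerivAt_pi.2 fun s => ?_
    by_cases h : (s : Coord n ι) = c
    · simp only [γ, h, Function.update_self, if_true]
      exact hasDerivAt_id _
    · simp only [γ, h, Function.update_of_ne, ne_eq, not_false_eq_true, if_false]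
      exact hasDerivAt_const _ _
  have hγ0 : γ (J.1 c) = restr E S J := by
    funext s; simp [γ, restr]
  have hcomp : HasDerivAt (fun t => g (γ t))
      (fderiv ℝ g (restr E S J) (fun s => if (s : Coord n ι) = c then 1 else 0)) (J.1 c) := by
    rw [← hγ0] at hgd ⊢
    exact hgd.comp_hasDerivAt _ hγ
  refine hcomp.congr_of_eventuallyEq ?_
  have hopen : IsOpen {t : ℝ | base (Function.update J.1 c t) ∈ E} :=
    E.isOpen.preimage (continuous_base.comp (continuous_const.update c continuous_id))
  filter_upwards [hopen.mem_nhds (by simp [J.2] : J.1 c ∈ _)] with t ht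
  rw [slice, dif_pos ht, hf]
  rfl

theorem slice_differentiableAt (c : Coord n ι) (f : Loc E) (J : Jet E) :
    DifferentiableAt ℝ (slice c f.1 J) (J.1 c) := by
  obtain ⟨f, S, g, hg, hf⟩ := f
  exact (hasDerivAt_slice c hg hf J).differentiableAt

theorem isLocal_deriv (c : Coord n ι) (f : Loc E) :
    IsLocal E fun J => deriv (slice c f.1 J) (J.1 c) := by
  classical
  obtain ⟨f, S, g, hg, hf⟩ := f
  refine ⟨S, fun q => fderiv ℝ g q (fun s => if (s : Coord n ι) = c then 1 else 0), ?_,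
    fun J => (hasDerivAt_slice c hg hf J).deriv⟩
  exact (hg.fderiv_of_isOpen (isOpen_range_restr S) (by simp)).clm_apply contDiffOn_const

open Classical in
theorem slice_self (c : Coord n ι) (f : Jet E → ℝ) (J : Jet E) :
    slice c f J (J.1 c) = f J := by
  have h : base (Function.update J.1 c (J.1 c)) ∈ E := by simpa using J.2
  rw [slice, dif_pos h]
  congr 1
  exact Subtype.ext (by simp)

theorem slice_add (c : Coord n ι) (f g : Jet E → ℝ) (J : Jet E) :
    slice c (f + g) J = slice c f J + slice c g J := by
  funext t; simp only [slice, Pi.add_apply]; split_ifs <;> simp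

theorem slice_smul (c : Coord n ι) (r : ℝ) (f : Jet E → ℝ) (J : Jet E) :
    slice c (r • f) J = r • slice c f J := by
  funext t; simp only [slice, Pi.smul_apply]; split_ifs <;> simp

theorem slice_mul (c : Coord n ι) (f g : Jet E → ℝ) (J : Jet E) :
    slice c (f * g) J = slice c f J * slice c g J := by
  funext t; simp only [slice, Pi.mul_apply]; split_ifs <;> simp

/-- The partial derivative of local functions along a coordinate of the jet space. -/
def pd (c : Coord n ι) : Derivation ℝ (Loc E) (Loc E) :=
  Derivation.mk'
    { toFun := fun f => ⟨fun J => deriv (slice c f.1 J) (J.1 c), isLocal_deriv c f⟩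
      map_add' := fun f g => Subtype.ext <| funext fun J => by
        have := deriv_add (slice_differentiableAt c f J) (slice_differentiableAt c g J)
        simpa [slice_add] using this
      map_smul' := fun r f => Subtype.ext <| funext fun J => by
        have := deriv_const_smul r (slice_differentiableAt c f J)
        simpa [slice_smul] using this }
    (fun f g => Subtype.ext <| funext fun J => by
      have := deriv_mul (slice_differentiableAt c f J) (slice_differentiableAt c g J)
      rw [slice_self, slice_self] at this
      simp only [LinearMap.coe_mk, AddHom.coe_mk, MulMemClass.coe_mul, slice_mul, this,
        smul_eq_mul, AddMemClass.coe_add, Pi.add_apply, Pi.mul_apply]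
      ring)

/-- The weight `m₀! ⋯ m_{n-1}! / k!` of a tuple `(μ₁, …, μ_k)` in which the index `ν` occurs
`m_ν` times: it equals `δ^{μ₁}_{(μ₁} ⋯ δ^{μ_k}_{μ_k)}`. -/
def symWeight (μ : List (Fin n)) : ℝ :=
  (∏ ν : Fin n, ((μ.count ν).factorial : ℝ)) / (μ.length.factorial : ℝ)

/-- The symmetrized derivative `∂^S/∂φ^i_{(μ)}` on local functions, `(μ)` being a tuple. -/
def pdS (i : ι) (μ : List (Fin n)) : Loc E →ₗ[ℝ] Loc E :=
  symWeight μ • (pd (E := E) (Sum.inr (i, (μ : Multiset (Fin n))))).toLinearMap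

/-! ### Forms -/

/-- The real exterior algebra on the generators `dx^μ` (labelled by `Sum.inl μ`) and
`d_V φ^i_{(μ)}` (labelled by `Sum.inr (i, (μ))`), all of them anticommuting. -/
abbrev Gen (n : ℕ) (ι : Type*) := ExteriorAlgebra ℝ (Coord n ι →₀ ℝ)

/-- The algebra of differential forms on the jet space with local coefficients. -/
abbrev Form (E : TopologicalSpace.Opens ((Fin n → ℝ) × (ι → ℝ))) := Loc E ⊗[ℝ] Gen n ι

/-- A generator of the exterior algebra. -/
def gen (c : Coord n ι) : Gen n ι := ExteriorAlgebra.ι ℝ (Finsupp.single c (1 : ℝ))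

/-- Local functions as forms of degree zero. -/
def ofLoc (f : Loc E) : Form E := f ⊗ₜ[ℝ] (1 : Gen n ι)

/-- The contact form `d_V φ^i_{(μ)}`. -/
def dV (i : ι) (μ : List (Fin n)) : Form E :=
  (1 : Loc E) ⊗ₜ[ℝ] gen (Sum.inr (i, (μ : Multiset (Fin n))))

variable (E) in
/-- The `(p,s)`-forms: sums of terms `f dx^{μ₁} ⋯ dx^{μ_p} d_Vφ^{i₁}_{(ν₁)} ⋯ d_Vφ^{i_s}_{(ν_s)}`
with local functions `f`. -/
def formsOfType (p s : ℕ) : Submodule ℝ (Form E) :=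
  Submodule.span ℝ {ω | ∃ (f : Loc E) (a : Fin p → Fin n) (b : Fin s → ι × Multiset (Fin n)),
    ω = f ⊗ₜ[ℝ] ((List.ofFn fun k => gen (Sum.inl (a k))).prod *
      (List.ofFn fun k => gen (Sum.inr (b k))).prod)}

/-- `∂/∂x^ν`, acting on the coefficients of a form. -/
def pdxForm (ν : Fin n) : Form E →ₗ[ℝ] Form E :=
  LinearMap.rTensor (Gen n ι) (pd (E := E) (Sum.inl ν)).toLinearMap

/-- `∂^S/∂φ^i_{(μ)}`, acting on the coefficients of a form. -/
def pdSForm (i : ι) (μ : List (Fin n)) : Form E →ₗ[ℝ] Form E :=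
  LinearMap.rTensor (Gen n ι) (pdS i μ : Loc E →ₗ[ℝ] Loc E)

/-- The left derivative of a form with respect to an anticommuting generator. -/
def contr (c : Coord n ι) : Form E →ₗ[ℝ] Form E :=
  LinearMap.lTensor (Loc E)
    (CliffordAlgebra.contractLeft (Q := (0 : QuadraticForm ℝ (Coord n ι →₀ ℝ)))
      (Finsupp.lapply c : (Coord n ι →₀ ℝ) →ₗ[ℝ] ℝ))

/-- `∂/∂dx^ν`. -/
def pddx (ν : Fin n) : Form E →ₗ[ℝ] Form E := contr (Sum.inl ν)

/-- `∂^S/∂d_Vφ^i_{(μ)}`. -/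
def pdSdV (i : ι) (μ : List (Fin n)) : Form E →ₗ[ℝ] Form E :=
  symWeight μ • contr (E := E) (Sum.inr (i, (μ : Multiset (Fin n))))

variable [Fintype ι]

/-- The total derivative
`∂_ν = ∂/∂x^ν + φ^i_{ν(μ)} ∂^S/∂φ^i_{(μ)} + d_Vφ^i_{ν(μ)} ∂^S/∂d_Vφ^i_{(μ)}`,
summed over the fields and over all tuples `(μ)`; on a given form only finitely many terms are
nonzero, and the same holds for all sums over tuples below. -/
def totalD (ν : Fin n) (ω : Form E) : Form E :=
  pdxForm ν ω + ∑ᶠ μ : List (Fin n), ∑ i : ι,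
    (ofLoc (coord (Sum.inr (i, ((ν :: μ : List (Fin n)) : Multiset (Fin n))))) * pdSForm i μ ω
      + dV i (ν :: μ) * pdSdV i μ ω)

/-- `∂_{(μ)} = ∂_{μ₁} ⋯ ∂_{μ_k}`. -/
def totalDs (μ : List (Fin n)) (ω : Form E) : Form E := μ.foldr totalD ω

/-- `(-∂)_{(μ)} = (-1)^k ∂_{μ₁} ⋯ ∂_{μ_k}`. -/
def negTotalDs (μ : List (Fin n)) (ω : Form E) : Form E :=
  (-1 : ℝ) ^ μ.length • totalDs μ ω

/-- Multiple integration by parts: the coefficients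
`R^{(μ)} = binom(|μ|+|ρ|, |μ|) (-∂)_{(ρ)} P^{((μ)(ρ))}` obtained from coefficients `P^{(μ)}`. -/
def byParts (P : List (Fin n) → Form E) (μ : List (Fin n)) : Form E :=
  ∑ᶠ ρ : List (Fin n), ((μ.length + ρ.length).choose μ.length : ℝ) •
    negTotalDs ρ (P (μ ++ ρ))

/-- The higher order Euler-Lagrange (Lie-Euler) derivative `δω/δφ^i_{(μ)}`. -/
def lieEuler (i : ι) (μ : List (Fin n)) (ω : Form E) : Form E :=
  byParts (fun μ' => pdSForm i μ' ω) μ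

/-- The Euler-Lagrange derivative `δω/δφ^i`. -/
def eulerLagrange (i : ι) (ω : Form E) : Form E := lieEuler i [] ω

/-- The horizontal homotopy operator on forms of horizontal degree `p`,
`(|μ|+1)/(n-p+|μ|+1) ∂_{(μ)} (a^i δ/δφ^i_{(μ)ν} ∂ω/∂dx^ν)`, where `a^i` is `d_Vφ^i` or `Q^i`. -/
def homotopyOp (p : ℕ) (a : ι → Form E) (ω : Form E) : Form E :=
  ∑ᶠ μ : List (Fin n), (((μ.length : ℝ) + 1) / ((n : ℝ) - (p : ℝ) + (μ.length : ℝ) + 1)) •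
    ∑ i : ι, ∑ ν : Fin n, totalDs μ (a i * lieEuler i (μ ++ [ν]) (pddx ν ω))

/-- `I^p_{d_Vφ}`. -/
def homotopyV (p : ℕ) (ω : Form E) : Form E := homotopyOp p (fun i => dV i []) ω

/-- `I^p_Q`. -/
def homotopyQ (p : ℕ) (Q : ι → Loc E) (ω : Form E) : Form E :=
  homotopyOp p (fun i => ofLoc (Q i)) ω

/-- The inner product `i_Q ω = ∂_{(μ)}Q^i ∂^S ω/∂d_Vφ^i_{(μ)}`. -/
def innerQ (Q : ι → Loc E) (ω : Form E) : Form E :=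
  ∑ᶠ μ : List (Fin n), ∑ i : ι, totalDs μ (ofLoc (Q i)) * pdSdV i μ ω

/-- The form `T_{Q₁}[Q₂, δω/δφ] = ∂_{(μ)} (Q₂^i R_i^{(μ)ν}[∂/∂dx^ν δω/δφ])`, where
`R_i^{(μ)}[X]` is obtained by integration by parts from
`P_i^{(μ)}[X] = ∂^S Q₁^j/∂φ^i_{(μ)} X_j`. -/
def formT (Q₁ Q₂ : ι → Loc E) (X : ι → Form E) : Form E :=
  ∑ᶠ μ : List (Fin n), ∑ i : ι, ∑ ν : Fin n,
    totalDs μ (ofLoc (Q₂ i) *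
      byParts (fun μ' => ∑ j : ι, ofLoc (pdS i μ' (Q₁ j)) * pddx ν (X j)) (μ ++ [ν]))

/-- The invariant presymplectic `(n-1,2)`-form
`W_{δω/δφ} = -1/2 I^n_{d_Vφ} (d_Vφ^i δω/δφ^i)` of a horizontal `n`-form `ω`. -/
def presymplectic (ω : Form E) : Form E :=
  -((1 / 2 : ℝ) • homotopyV n (∑ i : ι, dV i [] * eulerLagrange i ω))

/-- `W_{δω/δφ}[Q₁, Q₂] = i_{Q₂} i_{Q₁} W_{δω/δφ}`. -/
def presymplecticEval (ω : Form E) (Q₁ Q₂ : ι → Loc E) : Form E :=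
  innerQ Q₂ (innerQ Q₁ (presymplectic ω))

end VarBicomplex

end

/-! Write `J(Q₁, Q₂)` for the bilinear expression closing the proposition (`current`), with `X_j =
δω/δφ^j`. Two of the three ingredients are formal. By the Leibniz rule, `I_{Q₁}(Q₂^j X_j)` exceeds
`J(Q₁, Q₂)` by the terms in which the field derivative falls on `Q₂`, and these make up `T`
(`homotopyQ_sub_formT`). Since `i_Q` commutes with total derivatives, contracting `-½
I_{d_Vφ}(d_Vφ^j X_j)` with `Q₁`, then `Q₂`, gives `½ (J(Q₁, Q₂) - J(Q₂, Q₁))`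
(`innerQ_innerQ_homotopyV`). What remains is `J(Q₂, Q₁) = -J(Q₁, Q₂)`, and only here does it matter
that `X` is an Euler-Lagrange derivative (`current_eulerLagrange_antisymm`).

Antisymmetry is a computation with symbols. Let `a`, `b`, `c` be the total derivatives acting on
`Q₁`, on `Q₂` and on the remaining coefficient. The outer derivative of the product is `D = a + b +
c`, the inner one is `e = -(b + c)`. Because `binom(m+r+1, m+1) = (m+r+1) binom(m+r, m) ∫₀¹ τ^m dτ`,
all weights sum up: a differential operator with symbol `p(u)` contributes `∫₀¹ (∂p/∂u_ν)(τD + e)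
dτ` to the current (`sum_words_choose_eq_avgSymbol`). Exchanging `Q₁` and `Q₂` replaces `e` by `-(a
+ c)`; the formal adjoint `u ↦ -(c + u)` together with `τ ↦ 1 - τ` restores the old integrand up to
sign (`avgSymbol_adjSymbol`). For an Euler-Lagrange derivative, the coefficient `∂²ω/∂φ^i_s ∂φ^j_t`
comes with the symbol `adj(u^t) u^s`, whose adjoint `u^t adj(u^s)` is the same expression with `s`
and `t` exchanged. Commuting second derivatives thus make the linearization self-adjoint.

To have `a`, `b`, `c` as independent commuting variables, products are lifted to the tensor product
`Triple` and multiplied out by `mul₁₂₃` only at the end. The coefficients `∂X/∂φ` in the currents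
are horizontal, so total derivatives there act on coefficients alone. -/

set_option linter.unusedSectionVars false

noncomputable section

namespace VarBicomplex

open Finset

/-! ### Finite sums over words and multisets -/

section Words

variable {α : Type*} [Fintype α] {M : Type*} [AddCommMonoid M]

/-- The words of length `k`. -/
def words (α : Type*) [Fintype α] (k : ℕ) : Finset (List α) := (List.finite_length_eq α k).toFinset

/-- The words of length at most `N`. -/
def wordsLE (α : Type*) [Fintype α] (N : ℕ) : Finset (List α) :=
  (List.finite_length_le α N).toFinset

/-- The multisets of cardinality `k`. -/
def msets (α : Type*) [Fintype α] [DecidableEq α] (k : ℕ) : Finset (Multiset α) :=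
  (words α k).image (↑)

/-- The multisets of cardinality at most `N`. -/
def msetsLE (α : Type*) [Fintype α] [DecidableEq α] (N : ℕ) : Finset (Multiset α) :=
  (wordsLE α N).image (↑)

@[simp] theorem mem_words {k : ℕ} {w : List α} : w ∈ words α k ↔ w.length = k := by
  simp [words]

@[simp] theorem mem_wordsLE {k : ℕ} {w : List α} : w ∈ wordsLE α k ↔ w.length ≤ k := by
  simp [wordsLE]

@[simp] theorem mem_msets [DecidableEq α] {k : ℕ} {s : Multiset α} : s ∈ msets α k ↔ s.card = k := by
  induction s using Quotient.inductionOn with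
  | h l =>
    refine mem_image.trans ⟨?_, fun h => ⟨l, mem_words.2 h, rfl⟩⟩
    rintro ⟨a, h, e⟩
    rw [← mem_words.1 h, ← e]; rfl

@[simp] theorem mem_msetsLE [DecidableEq α] {k : ℕ} {s : Multiset α} : s ∈ msetsLE α k ↔ s.card ≤ k := by
  induction s using Quotient.inductionOn with
  | h l =>
    refine mem_image.trans ⟨?_, fun h => ⟨l, mem_wordsLE.2 h, rfl⟩⟩
    rintro ⟨a, h, e⟩
    rw [← e]; exact mem_wordsLE.1 h

theorem sum_words_zero (F : List α → M) : ∑ w ∈ words α 0, F w = F [] := by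
  have : words α 0 = {[]} := by ext; simp
  rw [this, sum_singleton]

theorem sum_words_succ (k : ℕ) (F : List α → M) :
    ∑ w ∈ words α (k + 1), F w = ∑ a : α, ∑ w ∈ words α k, F (a :: w) := by
  rw [← sum_product' (f := fun a w => F (a :: w))]
  symm
  refine sum_bij (fun p _ => p.1 :: p.2) ?_ ?_ ?_ ?_
  · rintro ⟨a, w⟩ h; simpa using h
  · rintro ⟨a, w⟩ _ ⟨b, v⟩ _ h; simpa using h
  · rintro (_ | ⟨a, w⟩) h
    · simp at h
    · exact ⟨(a, w), by simpa using h, rfl⟩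
  · intros; rfl

theorem sum_wordsLE (N : ℕ) (F : List α → M) :
    ∑ w ∈ wordsLE α N, F w = ∑ k ∈ range (N + 1), ∑ w ∈ words α k, F w := by
  rw [← sum_fiberwise_of_maps_to (g := List.length) (t := range (N + 1))]
  · refine sum_congr rfl fun k hk => sum_congr ?_ fun _ _ => rfl
    ext w
    simp only [mem_range, mem_filter, mem_wordsLE, mem_words] at hk ⊢
    omega
  · intro w hw
    simp only [mem_wordsLE, mem_range] at hw ⊢
    omega

theorem sum_msetsLE [DecidableEq α] (N : ℕ) (F : Multiset α → M) :
    ∑ s ∈ msetsLE α N, F s = ∑ k ∈ range (N + 1), ∑ s ∈ msets α k, F s := by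
  rw [← sum_fiberwise_of_maps_to (g := Multiset.card) (t := range (N + 1))]
  · refine sum_congr rfl fun k hk => sum_congr ?_ fun _ _ => rfl
    ext w
    simp only [mem_range, mem_filter, mem_msetsLE, mem_msets] at hk ⊢
    omega
  · intro w hw
    simp only [mem_msetsLE, mem_range] at hw ⊢
    omega

theorem finsum_words {N : ℕ} {F : List α → M} (h : ∀ w, N < w.length → F w = 0) :
    ∑ᶠ w, F w = ∑ w ∈ wordsLE α N, F w := by
  refine finsum_eq_sum_of_support_subset _ fun w hw => ?_
  by_contra hn
  exact hw (h w (by simpa using hn))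

/-- Sums over the multisets of cardinality `k + 1` that contain a given element. -/
theorem sum_msets_succ [DecidableEq α] {V : Type*} [AddCommMonoid V] (a : α) (k : ℕ) (G : Multiset α → V)
    (hG : ∀ s, a ∉ s → G s = 0) :
    ∑ s ∈ msets α (k + 1), G s = ∑ s ∈ msets α k, G (a ::ₘ s) := by
  symm
  rw [← sum_image (s := msets α k) (g := fun s => a ::ₘ s) (f := G)
    (fun s _ t _ h => (Multiset.cons_inj_right a).1 h)]
  refine sum_subset ?_ ?_
  · intro s hs
    obtain ⟨t, ht, rfl⟩ := mem_image.1 hs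
    simpa using ht
  · intro s hs hn
    refine hG s fun ha => hn ?_
    obtain ⟨t, rfl⟩ := Multiset.exists_cons_of_mem ha
    exact mem_image.2 ⟨t, by simpa using hs, rfl⟩

/-- Adding `a` maps the range up to `N` into the range up to `N + 1`; `hN` removes the overhang, so
the same cutoff serves on both sides. -/
theorem sum_msetsLE_cons [DecidableEq α] {V : Type*} [AddCommMonoid V] (a : α) (N : ℕ) (G : Multiset α → V)
    (hG : ∀ s, a ∉ s → G s = 0) (hN : ∀ s, N < s.card → G s = 0) :
    ∑ s ∈ msetsLE α N, G s = ∑ s ∈ msetsLE α N, G (a ::ₘ s) := by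
  symm
  rw [← sum_image (s := msetsLE α N) (g := fun s => a ::ₘ s) (f := G)
    (fun s _ t _ h => (Multiset.cons_inj_right a).1 h)]
  symm
  refine sum_congr_of_eq_on_inter ?_ ?_ (fun _ _ _ => rfl)
  · intro s hs hn
    refine hG s fun ha => hn ?_
    obtain ⟨t, rfl⟩ := Multiset.exists_cons_of_mem ha
    exact mem_image.2 ⟨t, by simp only [mem_msetsLE, Multiset.card_cons] at hs ⊢; omega, rfl⟩
  · intro s hs hn
    exact hN s (by simpa using hn)

end Words

/-! ### Symmetrization weights -/

section Weights

variable {n : ℕ}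

theorem symWeight_perm {l l' : List (Fin n)} (h : l.Perm l') : symWeight l = symWeight l' := by
  simp only [symWeight, h.length_eq, h.count_eq]

theorem symWeight_nil : symWeight ([] : List (Fin n)) = 1 := by simp [symWeight]

/-- Only the factor `m_a!` of the numerator and the factorial of the length change. This recursion
drives the passage from words to multisets. -/
theorem symWeight_cons (a : Fin n) (l : List (Fin n)) :
    ((l.length : ℝ) + 1) * symWeight (a :: l) = ((l.count a : ℝ) + 1) * symWeight l := by
  have h : (∏ ν : Fin n, (((a :: l).count ν).factorial : ℝ))
      = ((l.count a : ℝ) + 1) * ∏ ν : Fin n, ((l.count ν).factorial : ℝ) := by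
    rw [← mul_prod_erase univ _ (mem_univ a), ← mul_prod_erase univ (fun ν => ((l.count ν).factorial : ℝ)) (mem_univ a),
      List.count_cons_self, Nat.factorial_succ, ← mul_assoc]
    push_cast
    congr 1
    refine prod_congr rfl fun ν hν => ?_
    rw [List.count_cons_of_ne (Ne.symm (ne_of_mem_erase hν))]
  have h0 : (l.length.factorial : ℝ) ≠ 0 := by positivity
  have h1 : (l.length : ℝ) + 1 ≠ 0 := by positivity
  simp only [symWeight]
  rw [h, List.length_cons, Nat.factorial_succ]
  push_cast
  field_simp

variable {V : Type*} [AddCommGroup V] [Module ℝ V]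

/-- The weights turn sums over words into sums over multisets. -/
theorem sum_words_symWeight (k : ℕ) (G : Multiset (Fin n) → V) :
    ∑ w ∈ words (Fin n) k, symWeight w • G w = ∑ s ∈ msets (Fin n) k, G s := by
  induction k generalizing G with
  | zero =>
    rw [sum_words_zero, symWeight_nil, one_smul]
    have : msets (Fin n) 0 = {0} := by ext; simp
    rw [this, sum_singleton]; rfl
  | succ k ih =>
    have hk : ((k : ℝ) + 1) ≠ 0 := by positivity
    -- After multiplication by `k + 1`, splitting off a first letter `a` weights each multiset `s`
    -- by the multiplicity of `a` in `s`; the multiplicities add up to `k + 1`.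
    apply smul_right_injective V hk
    simp only
    rw [sum_words_succ, smul_sum, smul_sum]
    have h1 : ∀ a : Fin n, ((k : ℝ) + 1) • ∑ w ∈ words (Fin n) k,
        symWeight (a :: w) • G ((a :: w : List (Fin n)) : Multiset (Fin n))
        = ∑ s ∈ msets (Fin n) (k + 1), (s.count a : ℝ) • G s := by
      intro a
      rw [sum_msets_succ a k _ (fun s hs => by simp [Multiset.count_eq_zero_of_notMem hs]),
        ← ih, smul_sum]
      refine sum_congr rfl fun w hw => ?_
      rw [mem_words] at hw
      rw [smul_smul, smul_smul, ← hw, symWeight_cons]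
      simp [mul_comm]
    rw [sum_congr rfl fun a _ => h1 a, sum_comm]
    refine sum_congr rfl fun s hs => ?_
    rw [← sum_smul]
    congr 1
    rw [mem_msets] at hs
    have := Multiset.sum_count_eq_card (s := univ) (m := s) (fun a _ => mem_univ a)
    rw [hs] at this
    exact_mod_cast this

theorem sum_wordsLE_symWeight (N : ℕ) (G : Multiset (Fin n) → V) :
    ∑ w ∈ wordsLE (Fin n) N, symWeight w • G w = ∑ s ∈ msetsLE (Fin n) N, G s := by
  rw [sum_wordsLE, sum_msetsLE]
  exact sum_congr rfl fun k _ => sum_words_symWeight k G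

end Weights

/-! ### Symbol calculus -/

section Symbols

variable {S : Type*} [CommRing S] [Algebra ℝ S]

/-- The integral `∫₀¹ p(τ) dτ` of a polynomial. -/
def unitIntegral (S : Type*) [CommRing S] [Algebra ℝ S] : Polynomial S →ₗ[S] S :=
  Polynomial.lsum fun k => ((k : ℝ) + 1)⁻¹ • LinearMap.id

theorem unitIntegral_monomial (k : ℕ) (r : S) :
    unitIntegral S (Polynomial.monomial k r) = ((k : ℝ) + 1)⁻¹ • r := by
  simp [unitIntegral, Polynomial.lsum_apply]

theorem unitIntegral_X_pow (k : ℕ) :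
    unitIntegral S (Polynomial.X ^ k) = ((k : ℝ) + 1)⁻¹ • (1 : S) := by
  rw [Polynomial.X_pow_eq_monomial, unitIntegral_monomial]

theorem unitIntegral_derivative (p : Polynomial S) :
    unitIntegral S p.derivative = p.eval 1 - p.eval 0 := by
  induction p using Polynomial.induction_on' with
  | add p q hp hq => simp only [map_add, hp, hq, Polynomial.eval_add]; ring
  | monomial k r =>
    rw [Polynomial.derivative_monomial, unitIntegral_monomial]
    rcases k with _ | k
    · simp
    · have h : ((k : ℝ) + 1) ≠ 0 := by positivity
      have h2 : (r * ((k + 1 : ℕ) : S)) = ((k : ℝ) + 1) • r := by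
        rw [Algebra.smul_def]; simp [mul_comm]
      rw [Nat.add_sub_cancel, h2, smul_smul, inv_mul_cancel₀ h]
      simp

/-- The substitution `τ ↦ 1 - τ`: on monomials it follows from the fundamental theorem applied to
the antiderivative `-(1 - X)^(k+1)`. -/
theorem unitIntegral_comp_one_sub (p : Polynomial S) :
    unitIntegral S (p.comp (1 - Polynomial.X)) = unitIntegral S p := by
  induction p using Polynomial.induction_on' with
  | add p q hp hq => simp only [map_add, hp, hq, Polynomial.add_comp]
  | monomial k r =>
    have hk : ((k : ℝ) + 1) ≠ 0 := by positivity
    have h : (Polynomial.derivative (-(1 - Polynomial.X : Polynomial S) ^ (k + 1)))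
        = ((k : ℝ) + 1) • (1 - Polynomial.X : Polynomial S) ^ k := by
      rw [Polynomial.derivative_neg, Polynomial.derivative_pow, Algebra.smul_def]
      simp
    have h2 := unitIntegral_derivative (-(1 - Polynomial.X : Polynomial S) ^ (k + 1))
    rw [h, LinearMap.map_smul_of_tower] at h2
    have h3 : unitIntegral S ((1 - Polynomial.X : Polynomial S) ^ k)
        = ((k : ℝ) + 1)⁻¹ • (1 : S) := by
      rw [eq_inv_smul_iff₀ hk, h2]
      simp
    rw [Polynomial.monomial_comp, ← Polynomial.smul_eq_C_mul, map_smul, h3, unitIntegral_monomial,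
      smul_comm, smul_eq_mul, mul_one]

variable {n : ℕ}

/-- The symbol `∫₀¹ (∂p/∂u_ν)(τ D + e) dτ`. -/
def avgSymbol (D e : Fin n → S) (ν : Fin n) : MvPolynomial (Fin n) S →ₗ[S] S :=
  (unitIntegral S) ∘ₗ
    (MvPolynomial.aeval fun l => Polynomial.X * Polynomial.C (D l) + Polynomial.C (e l) :
      MvPolynomial (Fin n) S →ₐ[S] Polynomial S).toLinearMap ∘ₗ
    ((MvPolynomial.pderiv ν : Derivation S (MvPolynomial (Fin n) S) _) :
      MvPolynomial (Fin n) S →ₗ[S] MvPolynomial (Fin n) S)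

/-- The monomial `∏_{λ ∈ s} u_λ`. -/
def mono (S : Type*) [CommRing S] (s : Multiset (Fin n)) : MvPolynomial (Fin n) S :=
  (s.map MvPolynomial.X).prod

theorem mono_cons (a : Fin n) (s : Multiset (Fin n)) :
    mono S (a ::ₘ s) = MvPolynomial.X a * mono S s := by
  simp [mono]

theorem pderiv_mono_of_notMem {ν : Fin n} {s : Multiset (Fin n)} (h : ν ∉ s) :
    MvPolynomial.pderiv ν (mono S s) = 0 := by
  induction s using Multiset.induction_on with
  | empty => simp [mono]
  | cons a s ih =>
    rw [Multiset.mem_cons, not_or] at h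
    rw [mono_cons, MvPolynomial.pderiv_mul, ih h.2, MvPolynomial.pderiv_X_of_ne (Ne.symm h.1)]
    simp

/-- The multiplicity produced by `∂/∂u_ν` is the one appearing in `symWeight_cons`, which is why the
current of a differential operator involves the derivative of its symbol. -/
theorem pderiv_mono_cons (ν : Fin n) (s : Multiset (Fin n)) :
    MvPolynomial.pderiv ν (mono S (ν ::ₘ s)) = ((s.count ν : ℝ) + 1) • mono S s := by
  induction s using Multiset.induction_on with
  | empty => simp [mono]
  | cons a s ih =>
    rw [Multiset.cons_swap, mono_cons, MvPolynomial.pderiv_mul, ih]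
    by_cases h : a = ν
    · subst h
      rw [MvPolynomial.pderiv_X_self, mono_cons, Multiset.count_cons_self]
      push_cast
      simp only [Algebra.smul_def, map_add, map_natCast, map_one]
      ring
    · rw [MvPolynomial.pderiv_X_of_ne h, Multiset.count_cons_of_ne (Ne.symm h), mul_smul_comm,
        zero_mul, zero_add, mono_cons a s]

theorem avgSymbol_mono_of_notMem (D e : Fin n → S) {ν : Fin n} {s : Multiset (Fin n)}
    (h : ν ∉ s) : avgSymbol D e ν (mono S s) = 0 := by
  simp [avgSymbol, pderiv_mono_of_notMem h]

theorem avgSymbol_mono_cons (D e : Fin n → S) (ν : Fin n) (w : List (Fin n)) :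
    avgSymbol D e ν (mono S (ν ::ₘ (w : Multiset (Fin n)))) = ((w.count ν : ℝ) + 1) •
      unitIntegral S
        (w.map fun l => Polynomial.X * Polynomial.C (D l) + Polynomial.C (e l)).prod := by
  have h : avgSymbol D e ν (mono S (ν ::ₘ (w : Multiset (Fin n)))) = unitIntegral S
    ((MvPolynomial.aeval fun l => Polynomial.X * Polynomial.C (D l) + Polynomial.C (e l) :
      MvPolynomial (Fin n) S →ₐ[S] Polynomial S)
      (MvPolynomial.pderiv ν (mono S (ν ::ₘ (w : Multiset (Fin n)))))) := rfl
  rw [h, pderiv_mono_cons]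
  have h2 : ∀ (r : ℝ) (p : MvPolynomial (Fin n) S) (f : MvPolynomial (Fin n) S →ₐ[S] Polynomial S),
      f (r • p) = r • f p := fun r p f => LinearMap.map_smul_of_tower f.toLinearMap r p
  rw [h2, LinearMap.map_smul_of_tower, mono, map_multiset_prod]
  simp [Function.comp_def]

/-- The symbol of the formal adjoint. -/
def adjSymbol (c : Fin n → S) : MvPolynomial (Fin n) S →ₐ[S] MvPolynomial (Fin n) S :=
  MvPolynomial.aeval fun l => -(MvPolynomial.C (c l) + MvPolynomial.X l)

/-- Chain rule: the adjoint is an affine substitution of slope `-1` in each variable. This is the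
source of the sign in the antisymmetry. -/
theorem pderiv_adjSymbol (c : Fin n → S) (ν : Fin n) (p : MvPolynomial (Fin n) S) :
    MvPolynomial.pderiv ν (adjSymbol c p) = -adjSymbol c (MvPolynomial.pderiv ν p) := by
  induction p using MvPolynomial.induction_on with
  | C r => simp [adjSymbol, MvPolynomial.algebraMap_eq]
  | add p q hp hq => simp only [map_add, hp, hq]; ring
  | mul_X p l hp =>
    rw [map_mul, MvPolynomial.pderiv_mul, MvPolynomial.pderiv_mul, hp, map_add, map_mul, map_mul]
    have : MvPolynomial.pderiv ν (adjSymbol c (MvPolynomial.X l))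
        = -adjSymbol c (MvPolynomial.pderiv ν (MvPolynomial.X l)) := by
      by_cases h : l = ν
      · subst h; simp [adjSymbol]
      · simp [adjSymbol, MvPolynomial.pderiv_X_of_ne h]
    rw [this]
    ring

/-- Passing to the adjoint while exchanging the two arguments reverses the sign. -/
theorem avgSymbol_adjSymbol (a b c : Fin n → S) (ν : Fin n) (p : MvPolynomial (Fin n) S) :
    avgSymbol (fun l => a l + b l + c l) (fun l => -(a l + c l)) ν (adjSymbol c p)
      = -avgSymbol (fun l => a l + b l + c l) (fun l => -(b l + c l)) ν p := by
  simp only [avgSymbol, LinearMap.comp_apply, Derivation.coeFn_coe, pderiv_adjSymbol,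
    AlgHom.toLinearMap_apply, map_neg]
  -- With `D = a + b + c`, the adjoint substitution at `u = τD - (a + c)` gives `a - τD`, and `τ ↦ 1
  -- - τ` turns this into `τD - (b + c)`.
  rw [← unitIntegral_comp_one_sub]
  congr 2
  generalize MvPolynomial.pderiv ν p = q
  induction q using MvPolynomial.induction_on with
  | C r => simp [adjSymbol, MvPolynomial.algebraMap_eq]
  | add p q hp hq => rw [map_add, map_add, Polynomial.add_comp, hp, hq, map_add]
  | mul_X p l hp =>
    rw [map_mul, map_mul, Polynomial.mul_comp, hp, map_mul]
    congr 1
    simp [adjSymbol]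
    ring

end Symbols

/-! ### Binomial sums over words as integrals of symbols -/

section WordSums

variable {S : Type*} [CommRing S] [Algebra ℝ S] {V : Type*} [AddCommGroup V] [Module S V]
  [Module ℝ V] [IsScalarTower ℝ S V] {n : ℕ}

/-- The sum of `D^μ e^ρ g(μρ)` over words of lengths `m` and `r`. -/
def biSum (D e : Fin n → S) (g : Multiset (Fin n) → V) (m r : ℕ) : V :=
  ∑ μ ∈ words (Fin n) m, ∑ ρ ∈ words (Fin n) r,
    ((μ.map D).prod * (ρ.map e).prod) • g ((μ ++ ρ : List (Fin n)) : Multiset (Fin n))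

theorem biSum_succ_left (D e : Fin n → S) (g : Multiset (Fin n) → V) (m r : ℕ) :
    biSum D e g (m + 1) r = ∑ l, D l • biSum D e (fun s => g (l ::ₘ s)) m r := by
  simp only [biSum, sum_words_succ, smul_sum, smul_smul]
  refine sum_congr rfl fun l _ => sum_congr rfl fun μ _ => sum_congr rfl fun ρ _ => ?_
  simp [mul_assoc]

theorem biSum_succ_right (D e : Fin n → S) (g : Multiset (Fin n) → V) (m r : ℕ) :
    biSum D e g m (r + 1) = ∑ l, e l • biSum D e (fun s => g (l ::ₘ s)) m r := by
  simp only [biSum, sum_words_succ, smul_sum, smul_smul]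
  rw [sum_comm]
  refine sum_congr rfl fun l _ => ?_
  refine sum_congr rfl fun μ _ => sum_congr rfl fun ρ _ => ?_
  rw [List.map_cons, List.prod_cons, mul_left_comm]
  congr 2
  rw [Multiset.cons_coe]
  exact Multiset.coe_eq_coe.2 List.perm_middle

/-- The binomial theorem for symmetrized words. -/
theorem sum_words_binomial (D e : Fin n → S) (k : ℕ) (g : Multiset (Fin n) → V)
    (Λ : Polynomial S →ₗ[S] S) :
    ∑ w ∈ words (Fin n) k,
      Λ (w.map fun l => Polynomial.X * Polynomial.C (D l) + Polynomial.C (e l)).prod •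
        g (w : Multiset (Fin n))
      = ∑ ij ∈ antidiagonal k, k.choose ij.1 •
          (Λ (Polynomial.X ^ ij.1) • biSum D e g ij.1 ij.2) := by
  -- The first letter contributes `X D_l + e_l`. The factor `X` is absorbed into the functional `Λ`
  -- and the letter into `g`, hence both must vary.
  induction k generalizing g Λ with
  | zero => simp [sum_words_zero, biSum]
  | succ k ih =>
    rw [sum_antidiagonal_choose_succ_nsmul (fun i j => Λ (Polynomial.X ^ i) • biSum D e g i j),
      sum_words_succ]
    have h : ∀ l : Fin n, ∑ w ∈ words (Fin n) k,
        Λ ((l :: w).map fun l => Polynomial.X * Polynomial.C (D l) + Polynomial.C (e l)).prod •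
          g ((l :: w : List (Fin n)) : Multiset (Fin n))
        = D l • (∑ ij ∈ antidiagonal k, k.choose ij.1 •
            (Λ (Polynomial.X ^ (ij.1 + 1)) • biSum D e (fun s => g (l ::ₘ s)) ij.1 ij.2))
          + e l • ∑ ij ∈ antidiagonal k, k.choose ij.1 •
            (Λ (Polynomial.X ^ ij.1) • biSum D e (fun s => g (l ::ₘ s)) ij.1 ij.2) := by
      intro l
      have h1 := ih (fun s => g (l ::ₘ s)) (Λ ∘ₗ LinearMap.mulLeft S Polynomial.X)
      simp only [LinearMap.comp_apply, LinearMap.mulLeft_apply, ← pow_succ'] at h1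
      rw [← h1, ← ih (fun s => g (l ::ₘ s)) Λ, smul_sum, smul_sum, ← sum_add_distrib]
      refine sum_congr rfl fun w _ => ?_
      rw [smul_smul, smul_smul, ← add_smul]
      congr 1
      rw [← smul_eq_mul (D l), ← smul_eq_mul (e l), ← map_smul Λ, ← map_smul Λ, ← map_add]
      congr 1
      rw [List.map_cons, List.prod_cons, Polynomial.smul_eq_C_mul, Polynomial.smul_eq_C_mul]
      ring
    rw [sum_congr rfl fun l _ => h l, sum_add_distrib, add_comm]
    congr 1
    · simp only [smul_sum]
      rw [sum_comm]
      refine sum_congr rfl fun ij _ => ?_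
      rw [biSum_succ_right, smul_sum, smul_sum]
      refine sum_congr rfl fun l _ => ?_
      rw [smul_comm (e l), smul_comm (e l)]
    · simp only [smul_sum]
      rw [sum_comm]
      refine sum_congr rfl fun ij hij => ?_
      rw [biSum_succ_left, smul_sum, smul_sum]
      refine sum_congr rfl fun l _ => ?_
      rw [smul_comm (D l), smul_comm (D l),
        Nat.choose_symm_of_eq_add (HasAntidiagonal.mem_antidiagonal.1 hij).symm]

theorem sum_range_range_eq_sum_antidiagonal {M : Type*} [AddCommMonoid M] (N : ℕ) (h : ℕ → ℕ → M)
    (hh : ∀ m r, N < m + r → h m r = 0) :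
    ∑ m ∈ range (N + 1), ∑ r ∈ range (N + 1), h m r
      = ∑ k ∈ range (N + 1), ∑ ij ∈ antidiagonal k, h ij.1 ij.2 := by
  classical
  rw [← sum_product', sum_sigma', ← sum_filter_ne_zero]
  symm
  rw [← sum_filter_ne_zero]
  refine sum_bij' (fun x _ => x.2) (fun p _ => ⟨p.1 + p.2, p⟩) ?_ ?_ ?_ ?_ ?_
  · rintro ⟨k, m, r⟩ hx
    simp only [mem_filter, mem_sigma, mem_range, HasAntidiagonal.mem_antidiagonal, mem_product] at hx ⊢
    refine ⟨⟨?_, ?_⟩, hx.2⟩ <;> omega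
  · rintro ⟨m, r⟩ hx
    simp only [mem_filter, mem_sigma, mem_range, HasAntidiagonal.mem_antidiagonal, mem_product] at hx ⊢
    refine ⟨⟨?_, trivial⟩, hx.2⟩
    by_contra hn
    exact hx.2 (hh m r (by omega))
  · rintro ⟨k, m, r⟩ hx
    simp only [mem_filter, mem_sigma, mem_range, HasAntidiagonal.mem_antidiagonal, ne_eq] at hx
    obtain ⟨⟨_, rfl⟩, _⟩ := hx
    rfl
  · rintro ⟨m, r⟩ _; rfl
  · rintro ⟨k, m, r⟩ _; rfl

/-- In total length `k = m + r`, `binom(k+1, m+1) = (k+1) binom(k, m) ∫₀¹ τ^m dτ`. The factor `k +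
1` combines with the weight of the word extended by `ν` into the multiplicity created by `∂/∂u_ν`;
the rest is the binomial expansion of `∏ (τD + e)` under the integral. -/
theorem sum_words_choose_eq_avgSymbol (D e : Fin n → S) (ν : Fin n) (N : ℕ)
    (F : Multiset (Fin n) → V) (hF : ∀ s, N < s.card → F s = 0) :
    ∑ μ ∈ wordsLE (Fin n) N, ∑ ρ ∈ wordsLE (Fin n) N,
      (((μ.length + ρ.length + 1).choose (μ.length + 1) : ℝ) * symWeight (μ ++ ρ ++ [ν])) •
        ((μ.map D).prod * (ρ.map e).prod) • F ((μ ++ ρ ++ [ν] : List (Fin n)) : Multiset (Fin n))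
      = ∑ s ∈ msetsLE (Fin n) N, avgSymbol D e ν (mono S s) • F s := by
  -- The weight is a function of words but invariant under permutations, so any representative of
  -- the multiset may be used.
  set g : Multiset (Fin n) → V := fun s => symWeight (ν :: s.toList) • F (ν ::ₘ s) with hg
  have hgl : ∀ l : List (Fin n), g l = symWeight (ν :: l) • F (ν ::ₘ (l : Multiset (Fin n))) := by
    intro l
    simp only [hg]
    congr 1
    exact symWeight_perm ((Multiset.coe_eq_coe.1 (Multiset.coe_toList _)).cons ν)
  have hg0 : ∀ s, N < s.card + 1 → g s = 0 := by
    intro s hs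
    simp only [hg]
    rw [hF _ (by simpa using hs), smul_zero]
  have hL : ∀ μ ρ : List (Fin n),
      (((μ.length + ρ.length + 1).choose (μ.length + 1) : ℝ) * symWeight (μ ++ ρ ++ [ν])) •
        ((μ.map D).prod * (ρ.map e).prod) • F ((μ ++ ρ ++ [ν] : List (Fin n)) : Multiset (Fin n))
      = (μ.length + ρ.length + 1).choose (μ.length + 1) •
        (((μ.map D).prod * (ρ.map e).prod) • g ((μ ++ ρ : List (Fin n)) : Multiset (Fin n))) := by
    intro μ ρ
    have hp : (μ ++ ρ ++ [ν]).Perm (ν :: (μ ++ ρ)) := List.perm_append_singleton _ _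
    rw [hgl, mul_smul, Nat.cast_smul_eq_nsmul, symWeight_perm hp, smul_comm (symWeight _)]
    congr 3
    rw [Multiset.cons_coe, Multiset.coe_eq_coe.2 hp]
  simp only [hL]
  simp only [sum_wordsLE N]
  have hLL : ∀ m r : ℕ, (∑ μ ∈ words (Fin n) m, ∑ ρ ∈ words (Fin n) r,
      (μ.length + ρ.length + 1).choose (μ.length + 1) •
        (((μ.map D).prod * (ρ.map e).prod) • g ((μ ++ ρ : List (Fin n)) : Multiset (Fin n))))
      = (m + r + 1).choose (m + 1) • biSum D e g m r := by
    intro m r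
    simp only [biSum, smul_sum]
    refine sum_congr rfl fun μ hμ => sum_congr rfl fun ρ hρ => ?_
    rw [mem_words.1 hμ, mem_words.1 hρ]
  have hstep : ∑ m ∈ range (N + 1), ∑ μ ∈ words (Fin n) m, ∑ r ∈ range (N + 1),
      ∑ ρ ∈ words (Fin n) r, (μ.length + ρ.length + 1).choose (μ.length + 1) •
        (((μ.map D).prod * (ρ.map e).prod) • g ((μ ++ ρ : List (Fin n)) : Multiset (Fin n)))
      = ∑ m ∈ range (N + 1), ∑ r ∈ range (N + 1),
        (m + r + 1).choose (m + 1) • biSum D e g m r := by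
    refine sum_congr rfl fun m _ => ?_
    rw [sum_comm]
    exact sum_congr rfl fun r _ => hLL m r
  rw [hstep, sum_range_range_eq_sum_antidiagonal]
  swap
  · intro m r hmr
    have : biSum D e g m r = 0 := by
      refine sum_eq_zero fun μ hμ => sum_eq_zero fun ρ hρ => ?_
      rw [mem_words] at hμ hρ
      rw [hg0 _ (by simp; omega), smul_zero]
    rw [this, smul_zero]
  rw [sum_msetsLE_cons ν N _ (fun s hs => by rw [avgSymbol_mono_of_notMem D e hs, zero_smul])
    (fun s hs => by rw [hF s hs, smul_zero]), ← sum_wordsLE_symWeight, sum_wordsLE]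
  refine sum_congr rfl fun k _ => ?_
  have hR : ∀ w ∈ words (Fin n) k,
      symWeight w • avgSymbol D e ν (mono S (ν ::ₘ (w : Multiset (Fin n)))) •
        F (ν ::ₘ (w : Multiset (Fin n)))
      = ((k : ℝ) + 1) • (unitIntegral S
        (w.map fun l => Polynomial.X * Polynomial.C (D l) + Polynomial.C (e l)).prod •
          g (w : Multiset (Fin n))) := by
    intro w hw
    rw [mem_words] at hw
    rw [hgl, avgSymbol_mono_cons, smul_assoc, smul_smul, mul_comm, ← symWeight_cons, hw, mul_smul,
      smul_comm (symWeight (ν :: w))]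
  rw [sum_congr rfl hR, ← smul_sum, sum_words_binomial, smul_sum]
  refine sum_congr rfl fun ij hij => ?_
  rw [HasAntidiagonal.mem_antidiagonal] at hij
  rw [hij, unitIntegral_X_pow, smul_assoc, one_smul, ← Nat.cast_smul_eq_nsmul ℝ,
    ← Nat.cast_smul_eq_nsmul ℝ, smul_smul, smul_smul]
  congr 1
  have h1 : ((ij.1 : ℝ) + 1) ≠ 0 := by positivity
  have h2 := Nat.add_one_mul_choose_eq k ij.1
  have h3 : ((k : ℝ) + 1) * (k.choose ij.1 : ℝ) = ((k + 1).choose (ij.1 + 1) : ℝ) * (ij.1 + 1) := by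
    exact_mod_cast h2
  field_simp
  linarith

end WordSums

section

variable {n : ℕ} {ι : Type*} {E : TopologicalSpace.Opens ((Fin n → ℝ) × (ι → ℝ))}

/-! ### Partial and total derivatives of local functions -/

open Classical in
theorem pd_apply (c : Coord n ι) {f : Loc E} {S : Finset (Coord n ι)}
    {g : (S → ℝ) → ℝ} (hg : ContDiffOn ℝ ((⊤ : ℕ∞) : WithTop ℕ∞) g (Set.range (restr E S)))
    (hf : ∀ J, f.1 J = g (restr E S J)) (J : Jet E) :
    (pd c f).1 J = fderiv ℝ g (restr E S J) (fun s => if (s : Coord n ι) = c then 1 else 0) :=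
  (hasDerivAt_slice c hg hf J).deriv

open Classical in
theorem pd_coord (c d : Coord n ι) : pd c (coord d : Loc E) = if d = c then 1 else 0 := by
  refine Subtype.ext (funext fun J => ?_)
  rw [pd_apply c (S := {d}) (g := fun q => q ⟨d, by simp⟩) (contDiff_apply _ _ _).contDiffOn
    (fun _ => rfl)]
  have h := (ContinuousLinearMap.proj (R := ℝ) (φ := fun _ : ({d} : Finset (Coord n ι)) => ℝ)
    ⟨d, by simp⟩).hasFDerivAt (x := restr E {d} J)
  have h2 := h.fderiv
  change (fderiv ℝ (fun q : ({d} : Finset (Coord n ι)) → ℝ => q ⟨d, by simp⟩) _) _ = _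
  erw [h2]
  by_cases hd : d = c <;> simp [hd]

open Classical in
theorem exists_finset_pd_eq_zero (f : Loc E) :
    ∃ S : Finset (Coord n ι), ∀ c ∉ S, pd c f = 0 := by
  obtain ⟨S, g, hg, hf⟩ := f.2
  refine ⟨S, fun c hc => Subtype.ext (funext fun J => ?_)⟩
  rw [pd_apply c hg hf]
  have : (fun s : S => if (s : Coord n ι) = c then (1 : ℝ) else 0) = 0 := by
    funext s
    exact if_neg fun h : (s : Coord n ι) = c => hc (h ▸ s.2)
  rw [this, map_zero]
  rfl

-- Both sides are values of the second Fréchet derivative of the smooth function representing `f`,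
-- which is symmetric.
open Classical in
theorem pd_comm (c d : Coord n ι) (f : Loc E) : pd c (pd d f) = pd d (pd c f) := by
  obtain ⟨S, g, hg, hf⟩ := f.2
  have key : ∀ (c d : Coord n ι) (J : Jet E), (pd c (pd d f)).1 J
      = fderiv ℝ (fderiv ℝ g) (restr E S J) (fun s => if (s : Coord n ι) = c then 1 else 0)
        (fun s => if (s : Coord n ι) = d then 1 else 0) := by
    intro c d J
    have hg2 : ContDiffOn ℝ ((⊤ : ℕ∞) : WithTop ℕ∞) (fderiv ℝ g) (Set.range (restr E S)) :=
      hg.fderiv_of_isOpen (isOpen_range_restr S) (by simp)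
    rw [pd_apply c (g := fun q => fderiv ℝ g q (fun s => if (s : Coord n ι) = d then 1 else 0))
      (hg2.clm_apply contDiffOn_const) (fun J => pd_apply d hg hf J)]
    have hmem : Set.range (restr E S) ∈ 𝓝 (restr E S J) :=
      (isOpen_range_restr S).mem_nhds ⟨J, rfl⟩
    have hd : DifferentiableAt ℝ (fderiv ℝ g) (restr E S J) :=
      (hg2.contDiffAt hmem).differentiableAt (by simp)
    rw [fderiv_clm_apply hd (differentiableAt_const _)]
    simp
  refine Subtype.ext (funext fun J => ?_)
  rw [key, key]
  have hmem : Set.range (restr E S) ∈ 𝓝 (restr E S J) :=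
    (isOpen_range_restr S).mem_nhds ⟨J, rfl⟩
  exact (((hg.contDiffAt hmem).isSymmSndFDerivAt (by
    simpa using WithTop.coe_le_coe.2 (le_top : (2 : ℕ∞) ≤ ⊤))) _ _).symm

/-- The label of `φ^i_{ν s}`, given the label `(i, s)`. -/
def raise (ν : Fin n) (c : ι × Multiset (Fin n)) : ι × Multiset (Fin n) := (c.1, ν ::ₘ c.2)

theorem raise_injective (ν : Fin n) : Function.Injective (raise (ι := ι) ν) := by
  rintro ⟨i, s⟩ ⟨j, t⟩ h
  simp only [raise, Prod.mk.injEq, Multiset.cons_inj_right] at h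
  exact Prod.ext h.1 h.2

theorem raise_comm (μ ν : Fin n) (c : ι × Multiset (Fin n)) :
    raise μ (raise ν c) = raise ν (raise μ c) := by
  simp [raise, Multiset.cons_swap]

/-- `∂/∂φ^i_{s}` on local functions. -/
def pdv (c : ι × Multiset (Fin n)) (f : Loc E) : Loc E := pd (Sum.inr c) f

theorem finite_support_pdv (f : Loc E) : {c | pdv (E := E) c f ≠ 0}.Finite := by
  classical
  obtain ⟨S, hS⟩ := exists_finset_pd_eq_zero f
  refine (S.finite_toSet.preimage (Sum.inr_injective.injOn)).subset fun c hc => ?_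
  by_contra hn
  exact hc (hS _ hn)

theorem finite_support_of_pdv {M : Type*} [AddCommMonoid M] (f : Loc E)
    (F : ι × Multiset (Fin n) → M) (hF : ∀ c, pdv c f = 0 → F c = 0) :
    (Function.support F).Finite :=
  (finite_support_pdv f).subset fun c hc h => hc (hF c h)

/-- The total derivative on local functions. -/
def dL (ν : Fin n) : Loc E →ₗ[ℝ] Loc E where
  toFun f := pd (Sum.inl ν) f + ∑ᶠ c, coord (Sum.inr (raise ν c)) * pdv c f
  map_add' f g := by
    have h := finsum_add_distrib
      (f := fun c : ι × Multiset (Fin n) => coord (E := E) (Sum.inr (raise ν c)) * pdv c f)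
      (g := fun c => coord (Sum.inr (raise ν c)) * pdv c g)
      (finite_support_of_pdv f _ fun c hc => by rw [hc, mul_zero])
      (finite_support_of_pdv g _ fun c hc => by rw [hc, mul_zero])
    have h2 : ∀ c : ι × Multiset (Fin n), coord (E := E) (Sum.inr (raise ν c)) * pdv c (f + g)
        = coord (Sum.inr (raise ν c)) * pdv c f + coord (Sum.inr (raise ν c)) * pdv c g := by
      intro c; rw [pdv, map_add, mul_add]; rfl
    simp only [h2]
    rw [h, map_add]
    abel
  map_smul' r f := by
    have h2 : ∀ c : ι × Multiset (Fin n), coord (E := E) (Sum.inr (raise ν c)) * pdv c (r • f)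
        = r • (coord (Sum.inr (raise ν c)) * pdv c f) := by
      intro c; rw [pdv, Derivation.map_smul, mul_smul_comm]; rfl
    simp only [h2]
    rw [Derivation.map_smul, RingHom.id_apply, smul_add, smul_finsum']
    exact finite_support_of_pdv f _ fun c hc => by rw [hc, mul_zero]

theorem dL_apply (ν : Fin n) (f : Loc E) :
    dL ν f = pd (Sum.inl ν) f + ∑ᶠ c, coord (Sum.inr (raise ν c)) * pdv c f := rfl

theorem dL_eq_sum (ν : Fin n) (f : Loc E) {T : Finset (ι × Multiset (Fin n))}
    (hT : ∀ c ∉ T, pdv c f = 0) :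
    dL ν f = pd (Sum.inl ν) f + ∑ c ∈ T, coord (Sum.inr (raise ν c)) * pdv c f := by
  rw [dL_apply, finsum_eq_sum_of_support_subset]
  intro c hc
  by_contra hn
  exact hc (by simp [hT c (by simpa using hn)])

theorem exists_finset_pdv_eq_zero (f : Loc E) :
    ∃ T : Finset (ι × Multiset (Fin n)), ∀ c ∉ T, pdv c f = 0 :=
  ⟨(finite_support_pdv f).toFinset, fun c hc => by simpa using hc⟩

theorem dL_mul (ν : Fin n) (f g : Loc E) : dL ν (f * g) = dL ν f * g + f * dL ν g := by
  classical
  obtain ⟨T, hT⟩ := exists_finset_pdv_eq_zero f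
  obtain ⟨U, hU⟩ := exists_finset_pdv_eq_zero g
  have hm : ∀ c, pdv c (f * g) = f * pdv c g + g * pdv c f := fun c => by
    simp only [pdv, Derivation.leibniz, smul_eq_mul]
  rw [dL_eq_sum ν f (T := T ∪ U) (fun c hc => hT c (by simp_all)),
    dL_eq_sum ν g (T := T ∪ U) (fun c hc => hU c (by simp_all)),
    dL_eq_sum ν (f * g) (T := T ∪ U) (fun c hc => by
      rw [mem_union, not_or] at hc
      rw [hm, hT c hc.1, hU c hc.2, mul_zero, mul_zero, add_zero]),
    Derivation.leibniz, add_mul, mul_add, sum_mul, mul_sum]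
  simp only [hm, smul_eq_mul, mul_add, sum_add_distrib]
  have h1 : ∀ c, coord (Sum.inr (raise ν c)) * (f * pdv c g)
      = f * (coord (Sum.inr (raise ν c)) * pdv c g) := fun c => mul_left_comm _ _ _
  have h2 : ∀ c, coord (Sum.inr (raise ν c)) * (g * pdv c f)
      = coord (Sum.inr (raise ν c)) * pdv c f * g := fun c => by ring
  simp only [h1, h2]
  ring

/-- The value of a family at the label `c` with one index `ν` removed, or zero if `ν` does not
occur in `c`. -/
def lowered {M : Type*} [Zero M] (ν : Fin n) (c : ι × Multiset (Fin n))
    (F : ι × Multiset (Fin n) → M) : M :=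
  if ν ∈ c.2 then F (c.1, c.2.erase ν) else 0

theorem lowered_raise {M : Type*} [Zero M] (ν : Fin n) (c : ι × Multiset (Fin n))
    (F : ι × Multiset (Fin n) → M) : lowered ν (raise ν c) F = F c := by
  simp [lowered, raise]

-- Commutators produce sums over the labels `d` with `raise ν d = c`; injectivity of `raise` leaves
-- at most one such label.
open Classical in
theorem lowered_eq_sum {M : Type*} [AddCommMonoid M] (ν : Fin n) (c : ι × Multiset (Fin n))
    (F : ι × Multiset (Fin n) → M) {T : Finset (ι × Multiset (Fin n))} (hT : ∀ d ∉ T, F d = 0) :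
    ∑ d ∈ T, (if raise ν d = c then F d else 0) = lowered ν c F := by
  rw [lowered]
  split_ifs with h
  · have hc : raise ν (c.1, c.2.erase ν) = c := by
      simp [raise, Multiset.cons_erase h]
    have : ∀ d, (raise ν d = c) ↔ d = (c.1, c.2.erase ν) := fun d =>
      ⟨fun e => raise_injective ν (e.trans hc.symm), fun e => by rw [e, hc]⟩
    simp only [this, sum_ite_eq']
    split_ifs with h2
    · rfl
    · exact (hT _ h2).symm
  · refine sum_eq_zero fun d _ => if_neg fun e => h ?_
    rw [← e]
    simp [raise]

/-- The commutator of a partial derivative with a total derivative. -/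
theorem pdv_dL (c : ι × Multiset (Fin n)) (ν : Fin n) (f : Loc E) :
    pdv c (dL ν f) = dL ν (pdv c f) + lowered ν c fun d => pdv d f := by
  classical
  obtain ⟨T, hT⟩ := exists_finset_pdv_eq_zero f
  rw [dL_eq_sum ν f hT, dL_eq_sum ν (pdv c f) (T := T)
    (fun d hd => by rw [pdv, pdv, pd_comm]; exact (congrArg _ (hT d hd)).trans (map_zero _))]
  rw [← lowered_eq_sum ν c _ hT, add_assoc, ← sum_add_distrib, pdv, map_add, pd_comm, map_sum]
  congr 1
  refine sum_congr rfl fun d _ => ?_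
  rw [Derivation.leibniz, pd_coord, smul_eq_mul, smul_eq_mul, pdv, pdv, pdv, pd_comm]
  congr 1
  simp only [Sum.inr.injEq]
  split_ifs <;> simp

theorem pd_inl_dL (μ ν : Fin n) (f : Loc E) :
    pd (Sum.inl μ) (dL ν f) = dL ν (pd (Sum.inl μ) f) := by
  classical
  obtain ⟨T, hT⟩ := exists_finset_pdv_eq_zero f
  rw [dL_eq_sum ν f hT, dL_eq_sum ν (pd (Sum.inl μ) f) (T := T)
    (fun d hd => by rw [pdv, pd_comm, ← pdv, hT d hd, map_zero])]
  rw [map_add, pd_comm, map_sum]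
  congr 1
  refine sum_congr rfl fun d _ => ?_
  rw [Derivation.leibniz, pd_coord, smul_eq_mul, smul_eq_mul, pdv, pdv, pd_comm]
  simp

theorem dL_coord (μ : Fin n) (c : ι × Multiset (Fin n)) :
    dL μ (coord (Sum.inr c) : Loc E) = coord (Sum.inr (raise μ c)) := by
  classical
  rw [dL_eq_sum μ _ (T := {c}) (fun d hd => ?_), pd_coord, sum_singleton, pdv, pd_coord]
  · simp
  · rw [pdv, pd_coord, if_neg]
    intro h
    exact hd (by simp [Sum.inr_injective h])

/-- The commutator term of `pdv_dL`, reindexed along `raise ν`, supplies exactly the terms where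
`∂_ν` hits the coordinate coefficients of `∂_μ f`; they agree since jet labels are symmetric. -/
theorem dL_comm (μ ν : Fin n) (f : Loc E) : dL μ (dL ν f) = dL ν (dL μ f) := by
  classical
  obtain ⟨T, hT⟩ := exists_finset_pdv_eq_zero f
  obtain ⟨U, hU⟩ := exists_finset_pdv_eq_zero (dL ν f)
  -- One index set must contain the labels of `f`, those of `∂_ν f`, and the raised labels on which
  -- the commutator term lives.
  have hT' : ∀ c ∉ T ∪ U ∪ T.image (raise ν), pdv c f = 0 := fun c hc => hT c (by simp_all)
  have hlow : ∀ c ∉ T ∪ U ∪ T.image (raise ν), (lowered ν c fun d => pdv d f) = 0 := by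
    intro c hc
    rw [lowered]
    split_ifs with h
    · refine hT _ fun h2 => hc ?_
      refine mem_union_right _ (mem_image.2 ⟨_, h2, ?_⟩)
      simp [raise, Multiset.cons_erase h]
    · rfl
  rw [dL_eq_sum μ (dL ν f) (T := T ∪ U ∪ T.image (raise ν)) (fun c hc => hU c (by simp_all)),
    pd_inl_dL, dL_eq_sum μ f hT', map_add, map_sum]
  congr 1
  simp only [pdv_dL, dL_mul, dL_coord, mul_add, sum_add_distrib]
  rw [add_comm]
  congr 1
  have h1 : ∑ c ∈ T ∪ U ∪ T.image (raise ν),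
      coord (E := E) (Sum.inr (raise μ c)) * lowered ν c (fun d => pdv d f)
      = ∑ c ∈ T.image (raise ν),
        coord (E := E) (Sum.inr (raise μ c)) * lowered ν c (fun d => pdv d f) := by
    symm
    refine sum_subset subset_union_right fun c _ hn => ?_
    rw [lowered]
    split_ifs with h
    · rw [hT _ fun h2 => hn (mem_image.2 ⟨_, h2, by simp [raise, Multiset.cons_erase h]⟩), mul_zero]
    · rw [mul_zero]
  rw [h1, sum_image (fun a _ b _ h => raise_injective ν h)]
  simp only [lowered_raise, raise_comm μ ν]
  refine sum_subset (fun c hc => by simp_all) fun c _ hn => ?_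
  rw [hT c hn, mul_zero]

end

section

variable {n : ℕ} {ι : Type*} {E : TopologicalSpace.Opens ((Fin n → ℝ) × (ι → ℝ))}

/-! ### Operators on forms -/

/-- Shortcut for the ring structure on forms. -/
abbrev formRing : Ring (Form E) := Algebra.TensorProduct.instRing

/-- Shortcut for the additive group of forms. -/
abbrev formAddCommGroup : AddCommGroup (Form E) := TensorProduct.addCommGroup

attribute [local instance] formRing formAddCommGroup

/-- `∂/∂φ^i_{s}`, acting on the coefficients of a form. -/
def pdF (c : ι × Multiset (Fin n)) : Form E →ₗ[ℝ] Form E :=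
  LinearMap.rTensor (Gen n ι) (pd (E := E) (Sum.inr c)).toLinearMap

/-- The total derivative acting on the coefficients of a form only. -/
def DH (ν : Fin n) : Form E →ₗ[ℝ] Form E := LinearMap.rTensor (Gen n ι) (dL ν)

/-- The contact form with a given label. -/
def contact (c : ι × Multiset (Fin n)) : Form E := (1 : Loc E) ⊗ₜ[ℝ] gen (Sum.inr c)

theorem dV_eq_contact (i : ι) (μ : List (Fin n)) : (dV i μ : Form E) = contact (i, ↑μ) := rfl

theorem pdSForm_eq (i : ι) (μ : List (Fin n)) (ω : Form E) :
    pdSForm i μ ω = symWeight μ • pdF (i, ↑μ) ω := by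
  rw [pdSForm, pdS, LinearMap.rTensor_smul]; rfl

theorem pdSdV_eq (i : ι) (μ : List (Fin n)) (ω : Form E) :
    pdSdV i μ ω = symWeight μ • contr (Sum.inr (i, ↑μ)) ω := rfl

theorem pdF_tmul (c : ι × Multiset (Fin n)) (f : Loc E) (g : Gen n ι) :
    pdF c (f ⊗ₜ[ℝ] g) = pdv c f ⊗ₜ[ℝ] g := rfl

theorem DH_tmul (ν : Fin n) (f : Loc E) (g : Gen n ι) :
    DH ν (f ⊗ₜ[ℝ] g) = dL ν f ⊗ₜ[ℝ] g := rfl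

theorem contr_tmul (c : Coord n ι) (f : Loc E) (g : Gen n ι) :
    contr c (f ⊗ₜ[ℝ] g) = f ⊗ₜ[ℝ] CliffordAlgebra.contractLeft
      (Q := (0 : QuadraticForm ℝ (Coord n ι →₀ ℝ)))
      (Finsupp.lapply c : (Coord n ι →₀ ℝ) →ₗ[ℝ] ℝ) g := rfl

theorem ofLoc_mul_tmul (h f : Loc E) (g : Gen n ι) :
    ofLoc h * (f ⊗ₜ[ℝ] g) = (h * f) ⊗ₜ[ℝ] g := by
  rw [ofLoc, Algebra.TensorProduct.tmul_mul_tmul, one_mul]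

theorem contact_mul_tmul (c : ι × Multiset (Fin n)) (f : Loc E) (g : Gen n ι) :
    contact c * (f ⊗ₜ[ℝ] g) = f ⊗ₜ[ℝ] (gen (Sum.inr c) * g) := by
  rw [contact, Algebra.TensorProduct.tmul_mul_tmul, one_mul]

theorem ofLoc_add (f g : Loc E) : (ofLoc (f + g) : Form E) = ofLoc f + ofLoc g :=
  TensorProduct.add_tmul _ _ _

theorem ofLoc_smul (r : ℝ) (f : Loc E) : (ofLoc (r • f) : Form E) = r • ofLoc f :=
  (TensorProduct.smul_tmul' r f _).symm

theorem ofLoc_zero : (ofLoc (0 : Loc E) : Form E) = 0 := TensorProduct.zero_tmul _ _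

theorem ofLoc_mul_comm (f g : Loc E) (ω : Form E) :
    ofLoc f * (ofLoc g * ω) = ofLoc g * (ofLoc f * ω) := by
  induction ω using TensorProduct.induction_on with
  | zero => simp
  | add x y hx hy => simp only [mul_add, hx, hy]
  | tmul h x => rw [ofLoc_mul_tmul, ofLoc_mul_tmul, ofLoc_mul_tmul, ofLoc_mul_tmul, mul_left_comm]

theorem pdF_ofLoc_mul (c : ι × Multiset (Fin n)) (f : Loc E) (ω : Form E) :
    pdF c (ofLoc f * ω) = ofLoc (pdv c f) * ω + ofLoc f * pdF c ω := by
  induction ω using TensorProduct.induction_on with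
  | zero => simp
  | add x y hx hy => simp only [mul_add, map_add, hx, hy]; abel
  | tmul h x =>
    rw [ofLoc_mul_tmul, pdF_tmul, pdF_tmul, ofLoc_mul_tmul, ofLoc_mul_tmul,
      ← TensorProduct.add_tmul, pdv, Derivation.leibniz, smul_eq_mul, smul_eq_mul, add_comm,
      mul_comm h]
    rfl

theorem DH_ofLoc_mul (ν : Fin n) (f : Loc E) (ω : Form E) :
    DH ν (ofLoc f * ω) = ofLoc (dL ν f) * ω + ofLoc f * DH ν ω := by
  induction ω using TensorProduct.induction_on with
  | zero => simp
  | add x y hx hy => simp only [mul_add, map_add, hx, hy]; abel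
  | tmul h x =>
    rw [ofLoc_mul_tmul, DH_tmul, DH_tmul, ofLoc_mul_tmul, ofLoc_mul_tmul,
      ← TensorProduct.add_tmul, dL_mul]

theorem contr_ofLoc_mul (c : Coord n ι) (f : Loc E) (ω : Form E) :
    contr c (ofLoc f * ω) = ofLoc f * contr c ω := by
  induction ω using TensorProduct.induction_on with
  | zero => simp
  | add x y hx hy => simp only [mul_add, map_add, hx, hy]
  | tmul h x => rw [ofLoc_mul_tmul, contr_tmul, contr_tmul, ofLoc_mul_tmul]

theorem ofLoc_mul_contact_mul (f : Loc E) (c : ι × Multiset (Fin n)) (ω : Form E) :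
    ofLoc f * (contact c * ω) = contact c * (ofLoc f * ω) := by
  induction ω using TensorProduct.induction_on with
  | zero => simp
  | add x y hx hy => simp only [mul_add, hx, hy]
  | tmul h x => rw [contact_mul_tmul, ofLoc_mul_tmul, ofLoc_mul_tmul, contact_mul_tmul]

theorem pdF_contact_mul (c d : ι × Multiset (Fin n)) (ω : Form E) :
    pdF c (contact d * ω) = contact d * pdF c ω := by
  induction ω using TensorProduct.induction_on with
  | zero => simp
  | add x y hx hy => simp only [mul_add, map_add, hx, hy]
  | tmul h x => rw [contact_mul_tmul, pdF_tmul, pdF_tmul, contact_mul_tmul]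

theorem contr_contact_mul [DecidableEq ι] (c : Coord n ι) (d : ι × Multiset (Fin n))
    (ω : Form E) :
    contr c (contact d * ω) = (if Sum.inr d = c then ω else 0) - contact d * contr c ω := by
  induction ω using TensorProduct.induction_on with
  | zero => simp
  | add x y hx hy =>
    simp only [mul_add, map_add, hx, hy]
    split_ifs <;> abel
  | tmul h x =>
    rw [contact_mul_tmul, contr_tmul, contr_tmul, contact_mul_tmul, gen]
    erw [CliffordAlgebra.contractLeft_ι_mul]
    rw [TensorProduct.tmul_sub]
    congr 1
    by_cases hdc : Sum.inr d = c
    · simp [hdc]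
    · simp [hdc]

theorem contr_pdF (c : Coord n ι) (d : ι × Multiset (Fin n)) (ω : Form E) :
    contr c (pdF d ω) = pdF d (contr c ω) := by
  induction ω using TensorProduct.induction_on with
  | zero => simp
  | add x y hx hy => simp only [map_add, hx, hy]
  | tmul h x => rw [pdF_tmul, contr_tmul, contr_tmul, pdF_tmul]

theorem contr_DH (c : Coord n ι) (ν : Fin n) (ω : Form E) :
    contr c (DH ν ω) = DH ν (contr c ω) := by
  induction ω using TensorProduct.induction_on with
  | zero => simp
  | add x y hx hy => simp only [map_add, hx, hy]
  | tmul h x => rw [DH_tmul, contr_tmul, contr_tmul, DH_tmul]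

theorem contr_contr (c d : Coord n ι) (ω : Form E) :
    contr c (contr d ω) = -contr d (contr c ω) := by
  induction ω using TensorProduct.induction_on with
  | zero => simp
  | add x y hx hy => simp only [map_add, hx, hy]; abel
  | tmul h x =>
    rw [contr_tmul, contr_tmul, contr_tmul, contr_tmul, ← TensorProduct.tmul_neg]
    congr 1
    exact CliffordAlgebra.contractLeft_comm _ _ _

theorem DH_comm (μ ν : Fin n) (ω : Form E) : DH μ (DH ν ω) = DH ν (DH μ ω) := by
  induction ω using TensorProduct.induction_on with
  | zero => simp
  | add x y hx hy => simp only [map_add, hx, hy]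
  | tmul h x => rw [DH_tmul, DH_tmul, DH_tmul, DH_tmul, dL_comm]

theorem pdF_comm (c d : ι × Multiset (Fin n)) (ω : Form E) :
    pdF c (pdF d ω) = pdF d (pdF c ω) := by
  induction ω using TensorProduct.induction_on with
  | zero => simp
  | add x y hx hy => simp only [map_add, hx, hy]
  | tmul h x => rw [pdF_tmul, pdF_tmul, pdF_tmul, pdF_tmul, pdv, pdv, pd_comm]; rfl

theorem pdF_DH (c : ι × Multiset (Fin n)) (ν : Fin n) (ω : Form E) :
    pdF c (DH ν ω) = DH ν (pdF c ω) + lowered ν c fun d => pdF d ω := by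
  induction ω using TensorProduct.induction_on with
  | zero => simp [lowered]
  | add x y hx hy =>
    simp only [map_add, hx, hy, lowered]
    split_ifs <;> abel
  | tmul h x =>
    rw [DH_tmul, pdF_tmul, pdF_tmul, DH_tmul, pdv_dL, TensorProduct.add_tmul]
    congr 1
    rw [lowered, lowered]
    split_ifs
    · rfl
    · exact TensorProduct.zero_tmul _ _

/-- Iterated total derivatives of the coefficients. -/
def DHs (μ : List (Fin n)) : Form E →ₗ[ℝ] Form E := (μ.map DH).prod

theorem DHs_cons (ν : Fin n) (μ : List (Fin n)) (ω : Form E) :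
    DHs (ν :: μ) ω = DH ν (DHs μ ω) := by
  simp [DHs]

theorem DHs_nil (ω : Form E) : DHs [] ω = ω := rfl

/-! ### Finiteness -/

/-- Bound on the order of the derivatives occurring in a form. -/
def OrderLE (N : ℕ) (ω : Form E) : Prop :=
  ∀ c : ι × Multiset (Fin n), N < c.2.card → pdF c ω = 0 ∧ contr (Sum.inr c) ω = 0

theorem OrderLE.mono {N M : ℕ} (h : N ≤ M) {ω : Form E} (hω : OrderLE N ω) : OrderLE M ω :=
  fun c hc => hω c (lt_of_le_of_lt h hc)

theorem OrderLE.add {N : ℕ} {ω η : Form E} (hω : OrderLE N ω) (hη : OrderLE N η) :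
    OrderLE N (ω + η) := fun c hc => by
  rw [map_add, map_add, (hω c hc).1, (hω c hc).2, (hη c hc).1, (hη c hc).2]; simp

theorem OrderLE.smul {N : ℕ} {ω : Form E} (r : ℝ) (hω : OrderLE N ω) :
    OrderLE N (r • ω) := fun c hc => by
  rw [map_smul, map_smul, (hω c hc).1, (hω c hc).2]; simp

theorem OrderLE.contr {N : ℕ} {ω : Form E} (d : Coord n ι) (hω : OrderLE N ω) :
    OrderLE N (contr d ω) := fun c hc => by
  rw [← contr_pdF, contr_contr, (hω c hc).1, (hω c hc).2]; simp

theorem exists_pdv_bound (f : Loc E) :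
    ∃ N : ℕ, ∀ c : ι × Multiset (Fin n), N < c.2.card → pdv c f = 0 := by
  obtain ⟨T, hT⟩ := exists_finset_pdv_eq_zero f
  refine ⟨T.sup fun c => c.2.card, fun c hc => hT c fun h => ?_⟩
  exact absurd (le_sup (f := fun c : ι × Multiset (Fin n) => c.2.card) h) (not_le.2 hc)

/-- An element of the exterior algebra is built from finitely many finitely supported vectors, and
contraction is an antiderivation. -/
theorem exists_contractLeft_bound (g : Gen n ι) :
    ∃ N : ℕ, ∀ c : ι × Multiset (Fin n), N < c.2.card → CliffordAlgebra.contractLeft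
      (Q := (0 : QuadraticForm ℝ (Coord n ι →₀ ℝ)))
      (Finsupp.lapply (Sum.inr c) : (Coord n ι →₀ ℝ) →ₗ[ℝ] ℝ) g = 0 := by
  classical
  induction g using CliffordAlgebra.left_induction with
  | algebraMap r => exact ⟨0, fun c _ => CliffordAlgebra.contractLeft_algebraMap _ _ _⟩
  | add x y hx hy =>
    obtain ⟨N, hN⟩ := hx
    obtain ⟨M, hM⟩ := hy
    exact ⟨max N M, fun c hc => by
      rw [map_add, hN c (lt_of_le_of_lt (le_max_left _ _) hc),
        hM c (lt_of_le_of_lt (le_max_right _ _) hc), add_zero]⟩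
  | ι_mul x v hx =>
    obtain ⟨N, hN⟩ := hx
    refine ⟨max N (v.support.sup fun d => Sum.elim (fun _ => 0) (fun c => c.2.card) d),
      fun c hc => ?_⟩
    rw [CliffordAlgebra.contractLeft_ι_mul, hN c (lt_of_le_of_lt (le_max_left _ _) hc), mul_zero,
      sub_zero]
    have : v (Sum.inr c) = 0 := by
      by_contra hv
      have h := le_sup (f := fun d : Coord n ι => Sum.elim (fun _ => 0) (fun c => c.2.card) d)
        (Finsupp.mem_support_iff.2 hv)
      exact absurd (h.trans (le_max_right _ _)) (not_le.2 hc)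
    simp [this]

theorem exists_orderLE (ω : Form E) : ∃ N, OrderLE N ω := by
  induction ω using TensorProduct.induction_on with
  | zero => exact ⟨0, fun c _ => by simp⟩
  | add x y hx hy =>
    obtain ⟨N, hN⟩ := hx
    obtain ⟨M, hM⟩ := hy
    exact ⟨max N M, (hN.mono (le_max_left _ _)).add (hM.mono (le_max_right _ _))⟩
  | tmul f g =>
    obtain ⟨N, hN⟩ := exists_pdv_bound f
    obtain ⟨M, hM⟩ := exists_contractLeft_bound g
    refine ⟨max N M, fun c hc => ⟨?_, ?_⟩⟩
    · rw [pdF_tmul, hN c (lt_of_le_of_lt (le_max_left _ _) hc), TensorProduct.zero_tmul]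
    · rw [contr_tmul, hM c (lt_of_le_of_lt (le_max_right _ _) hc), TensorProduct.tmul_zero]

theorem exists_orderLE_two (ω η : Form E) : ∃ N, OrderLE N ω ∧ OrderLE N η := by
  obtain ⟨N, hN⟩ := exists_orderLE ω
  obtain ⟨M, hM⟩ := exists_orderLE η
  exact ⟨max N M, hN.mono (le_max_left _ _), hM.mono (le_max_right _ _)⟩

variable [Fintype ι]

variable (n ι) in
/-- The labels of order at most `N`. -/
def labels (N : ℕ) : Finset (ι × Multiset (Fin n)) := univ ×ˢ msetsLE (Fin n) N

theorem mem_labels {N : ℕ} {c : ι × Multiset (Fin n)} : c ∈ labels n ι N ↔ c.2.card ≤ N := by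
  simp [labels]

theorem sum_labels {M : Type*} [AddCommMonoid M] (N : ℕ) (F : ι × Multiset (Fin n) → M) :
    ∑ c ∈ labels n ι N, F c = ∑ s ∈ msetsLE (Fin n) N, ∑ i, F (i, s) := by
  rw [labels, sum_product_right]

/-- The sums over tuples and fields in the definitions, as sums over labels. -/
theorem finsum_words_labels {V : Type*} [AddCommGroup V] [Module ℝ V] {N : ℕ}
    (F : ι × Multiset (Fin n) → V) (hF : ∀ c, N < c.2.card → F c = 0) :
    ∑ᶠ μ : List (Fin n), ∑ i : ι, symWeight μ • F (i, (μ : Multiset (Fin n)))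
      = ∑ c ∈ labels n ι N, F c := by
  rw [finsum_words (N := N), sum_labels, ← sum_wordsLE_symWeight]
  · simp only [smul_sum]
  · intro w hw
    refine sum_eq_zero fun i _ => ?_
    rw [hF _ (by simpa using hw), smul_zero]

/-- The two groups of terms that differentiate coefficients assemble into `DH`; only the contact
part needs the explicit finite sum. -/
theorem totalD_eq (ν : Fin n) {N : ℕ} {ω : Form E} (hω : OrderLE N ω) :
    totalD ν ω = DH ν ω + ∑ c ∈ labels n ι N, contact (raise ν c) * contr (Sum.inr c) ω := by
  have h1 : totalD ν ω = pdxForm ν ω + ∑ c ∈ labels n ι N,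
      (ofLoc (coord (Sum.inr (raise ν c))) * pdF c ω
        + contact (raise ν c) * contr (Sum.inr c) ω) := by
    rw [totalD, ← finsum_words_labels (N := N)]
    · congr 1
      refine finsum_congr fun μ => sum_congr rfl fun i _ => ?_
      rw [pdSForm_eq, pdSdV_eq, mul_smul_comm, mul_smul_comm, ← smul_add]
      rfl
    · intro c hc
      rw [(hω c hc).1, (hω c hc).2, mul_zero, mul_zero, add_zero]
  have h2 : ∀ (η : Form E) (M : ℕ), (∀ c, M < c.2.card → pdF c η = 0) →
      DH ν η = pdxForm ν η + ∑ c ∈ labels n ι M,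
        ofLoc (coord (Sum.inr (raise ν c))) * pdF c η := by
    -- The tensors in a decomposition of `η` may have higher order than `η` itself, so the formula
    -- is first obtained for large cutoffs `K` and then cut back to `M`, the extra terms being zero.
    have h3 : ∀ η : Form E, ∃ M : ℕ, ∀ K, M ≤ K → DH ν η = pdxForm ν η
        + ∑ c ∈ labels n ι K, ofLoc (coord (Sum.inr (raise ν c))) * pdF c η := by
      intro η
      induction η using TensorProduct.induction_on with
      | zero => exact ⟨0, fun K _ => by simp⟩
      | add x y hx hy =>
        obtain ⟨N, hN⟩ := hx
        obtain ⟨M, hM⟩ := hy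
        refine ⟨max N M, fun K hK => ?_⟩
        rw [map_add, hN K ((le_max_left _ _).trans hK), hM K ((le_max_right _ _).trans hK)]
        simp only [map_add, mul_add, sum_add_distrib]
        abel
      | tmul f g =>
        obtain ⟨N, hN⟩ := exists_pdv_bound f
        refine ⟨N, fun K hK => ?_⟩
        rw [DH_tmul, dL_eq_sum ν f (T := labels n ι K)
          (fun c hc => hN c (by rw [mem_labels] at hc; omega)), TensorProduct.add_tmul,
          TensorProduct.sum_tmul]
        congr 1
        refine sum_congr rfl fun c _ => ?_
        rw [pdF_tmul, ofLoc_mul_tmul]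
    intro η M hM
    obtain ⟨K, hK⟩ := h3 η
    rw [hK (max K M) (le_max_left _ _)]
    congr 1
    symm
    refine sum_subset (fun c hc => ?_) fun c _ hn => ?_
    · rw [mem_labels] at hc ⊢
      exact hc.trans (le_max_right _ _)
    · rw [hM c (by rw [mem_labels] at hn; omega), mul_zero]
  rw [h1, h2 ω N (fun c hc => (hω c hc).1), sum_add_distrib, add_assoc]

theorem totalD_add (ν : Fin n) (ω η : Form E) :
    totalD ν (ω + η) = totalD ν ω + totalD ν η := by
  obtain ⟨N, h1, h2⟩ := exists_orderLE_two ω η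
  rw [totalD_eq ν h1, totalD_eq ν h2, totalD_eq ν (h1.add h2)]
  simp only [map_add, mul_add, sum_add_distrib]
  abel

theorem totalD_smul (ν : Fin n) (r : ℝ) (ω : Form E) :
    totalD ν (r • ω) = r • totalD ν ω := by
  obtain ⟨N, h1⟩ := exists_orderLE ω
  rw [totalD_eq ν h1, totalD_eq ν (h1.smul r)]
  simp only [map_smul, mul_smul_comm, smul_add, smul_sum]

/-- The iterated total derivatives as linear maps. -/
def totalDsLin (μ : List (Fin n)) : Form E →ₗ[ℝ] Form E where
  toFun := totalDs μ
  map_add' ω η := by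
    induction μ with
    | nil => rfl
    | cons ν μ ih => exact (congrArg _ ih).trans (totalD_add _ _ _)
  map_smul' r ω := by
    induction μ with
    | nil => rfl
    | cons ν μ ih => exact (congrArg _ ih).trans (totalD_smul _ _ _)

theorem totalDsLin_apply (μ : List (Fin n)) (ω : Form E) : totalDsLin μ ω = totalDs μ ω := rfl

theorem totalD_ofLoc_mul (ν : Fin n) (f : Loc E) (ω : Form E) :
    totalD ν (ofLoc f * ω) = ofLoc (dL ν f) * ω + ofLoc f * totalD ν ω := by
  obtain ⟨N, h1, h2⟩ := exists_orderLE_two ω (ofLoc f * ω)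
  rw [totalD_eq ν h1, totalD_eq ν h2]
  simp only [contr_ofLoc_mul, DH_ofLoc_mul, mul_add, mul_sum, ofLoc_mul_contact_mul]
  abel

/-- The commutator of a contraction with a total derivative. -/
theorem contr_totalD (c : ι × Multiset (Fin n)) (ν : Fin n) (ω : Form E) :
    contr (Sum.inr c) (totalD ν ω) = totalD ν (contr (Sum.inr c) ω)
      + lowered ν c fun d => contr (Sum.inr d) ω := by
  classical
  obtain ⟨N, h⟩ := exists_orderLE ω
  rw [totalD_eq ν h, totalD_eq ν (h.contr _), map_add, contr_DH, map_sum,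
    ← lowered_eq_sum ν c _ (T := labels n ι N)
      (fun d hd => (h d (by rw [mem_labels] at hd; omega)).2), add_assoc, ← sum_add_distrib]
  congr 1
  refine sum_congr rfl fun d _ => ?_
  rw [contr_contact_mul, contr_contr (Sum.inr c), mul_neg, sub_neg_eq_add, add_comm]
  simp

/-! ### Horizontal forms -/

/-- A form is horizontal if it contains no contact forms. -/
def IsHorizontal (ω : Form E) : Prop :=
  ∀ c : ι × Multiset (Fin n), contr (Sum.inr c) ω = 0

theorem isHorizontal_zero : IsHorizontal (0 : Form E) := fun _ => map_zero _

theorem IsHorizontal.add {ω η : Form E} (hω : IsHorizontal ω) (hη : IsHorizontal η) :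
    IsHorizontal (ω + η) := fun c => by rw [map_add, hω c, hη c, add_zero]

theorem IsHorizontal.sum {α : Type*} {T : Finset α} {F : α → Form E}
    (h : ∀ a ∈ T, IsHorizontal (F a)) : IsHorizontal (∑ a ∈ T, F a) := fun c => by
  rw [map_sum, sum_eq_zero fun a ha => h a ha c]

theorem IsHorizontal.smul {ω : Form E} (r : ℝ) (hω : IsHorizontal ω) :
    IsHorizontal (r • ω) := fun c => by rw [map_smul, hω c, smul_zero]

theorem IsHorizontal.ofLoc_mul {ω : Form E} (f : Loc E) (hω : IsHorizontal ω) :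
    IsHorizontal (ofLoc f * ω) := fun c => by rw [contr_ofLoc_mul, hω c, mul_zero]

theorem IsHorizontal.pdF {ω : Form E} (d : ι × Multiset (Fin n)) (hω : IsHorizontal ω) :
    IsHorizontal (pdF d ω) := fun c => by rw [contr_pdF, hω c, map_zero]

theorem IsHorizontal.contr {ω : Form E} (d : Coord n ι) (hω : IsHorizontal ω) :
    IsHorizontal (contr d ω) := fun c => by rw [contr_contr, hω c, map_zero, neg_zero]

theorem IsHorizontal.DH {ω : Form E} (ν : Fin n) (hω : IsHorizontal ω) :
    IsHorizontal (DH ν ω) := fun c => by rw [contr_DH, hω c, map_zero]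

theorem IsHorizontal.totalD_eq {ω : Form E} (ν : Fin n) (hω : IsHorizontal ω) :
    totalD ν ω = VarBicomplex.DH ν ω := by
  obtain ⟨N, h⟩ := exists_orderLE ω
  rw [VarBicomplex.totalD_eq ν h, sum_eq_zero fun c _ => by rw [hω c, mul_zero], add_zero]

theorem IsHorizontal.DHs {ω : Form E} (μ : List (Fin n)) (hω : IsHorizontal ω) :
    IsHorizontal (DHs μ ω) := by
  induction μ with
  | nil => exact hω
  | cons ν μ ih => rw [DHs_cons]; exact ih.DH ν

theorem IsHorizontal.totalDs_eq {ω : Form E} (μ : List (Fin n)) (hω : IsHorizontal ω) :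
    totalDs μ ω = VarBicomplex.DHs μ ω := by
  induction μ with
  | nil => rfl
  | cons ν μ ih =>
    rw [DHs_cons, ← (hω.DHs μ).totalD_eq, ← ih]
    rfl

theorem isHorizontal_ofLoc (f : Loc E) : IsHorizontal (ofLoc f : Form E) := fun c => by
  rw [ofLoc, contr_tmul,
    CliffordAlgebra.contractLeft_one (Q := (0 : QuadraticForm ℝ (Coord n ι →₀ ℝ))),
    TensorProduct.tmul_zero]

theorem isHorizontal_of_mem_formsOfType {p : ℕ} {ω : Form E} (hω : ω ∈ formsOfType E p 0) :
    IsHorizontal ω := by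
  induction hω using Submodule.span_induction with
  | zero => exact isHorizontal_zero
  | add x y _ _ hx hy => exact hx.add hy
  | smul r x _ hx => exact hx.smul r
  | mem x hx =>
    obtain ⟨f, a, b, rfl⟩ := hx
    intro c
    rw [contr_tmul]
    simp only [List.ofFn_zero, List.prod_nil, mul_one]
    have : ∀ l : List (Gen n ι), (∀ x ∈ l, ∃ ν : Fin n, x = gen (Sum.inl ν)) →
        CliffordAlgebra.contractLeft (Q := (0 : QuadraticForm ℝ (Coord n ι →₀ ℝ)))
          (Finsupp.lapply (Sum.inr c) : (Coord n ι →₀ ℝ) →ₗ[ℝ] ℝ) l.prod = 0 := by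
      intro l hl
      induction l with
      | nil =>
        exact CliffordAlgebra.contractLeft_one (Q := (0 : QuadraticForm ℝ (Coord n ι →₀ ℝ))) _
      | cons x l ih =>
        obtain ⟨ν, rfl⟩ := hl x (by simp)
        rw [List.prod_cons, gen]
        erw [CliffordAlgebra.contractLeft_ι_mul]
        rw [ih fun x hx => hl x (by simp [hx])]
        simp
    rw [this _ (by simpa [List.mem_ofFn] using fun k => ⟨_, rfl⟩), TensorProduct.tmul_zero]

end

section

variable {n : ℕ} {ι : Type*} {E : TopologicalSpace.Opens ((Fin n → ℝ) × (ι → ℝ))}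

attribute [local instance] formRing formAddCommGroup

/-! ### The inner product with an evolutionary vector field -/

/-- Commutativity of total derivatives lets their iterates be indexed by multisets, like the jet
coordinates. -/
instance : LeftCommutative fun (ν : Fin n) (f : Loc E) => dL ν f := ⟨dL_comm⟩

/-- Iterated total derivatives of a local function. -/
def dLs (s : Multiset (Fin n)) (f : Loc E) : Loc E := s.foldr (fun ν f => dL ν f) f

theorem dLs_cons (ν : Fin n) (s : Multiset (Fin n)) (f : Loc E) :
    dLs (ν ::ₘ s) f = dL ν (dLs s f) := Multiset.foldr_cons _ _ _ _

variable [Fintype ι]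

theorem totalDs_ofLoc (μ : List (Fin n)) (f : Loc E) :
    totalDs μ (ofLoc f) = ofLoc (dLs (μ : Multiset (Fin n)) f) := by
  induction μ with
  | nil => rfl
  | cons ν μ ih =>
    rw [← Multiset.cons_coe, dLs_cons]
    exact (congrArg _ ih).trans ((isHorizontal_ofLoc _).totalD_eq ν)

theorem innerQ_eq (Q : ι → Loc E) {N : ℕ} {ω : Form E}
    (hω : ∀ c : ι × Multiset (Fin n), N < c.2.card → contr (Sum.inr c) ω = 0) :
    innerQ Q ω = ∑ c ∈ labels n ι N, ofLoc (dLs c.2 (Q c.1)) * contr (Sum.inr c) ω := by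
  rw [innerQ, ← finsum_words_labels (N := N)]
  · refine finsum_congr fun μ => sum_congr rfl fun i _ => ?_
    rw [pdSdV_eq, totalDs_ofLoc, mul_smul_comm]
  · intro c hc
    rw [hω c hc, mul_zero]

/-- The inner product as a linear map. -/
def innerQLin (Q : ι → Loc E) : Form E →ₗ[ℝ] Form E where
  toFun := innerQ Q
  map_add' ω η := by
    obtain ⟨N, h1, h2⟩ := exists_orderLE_two ω η
    rw [innerQ_eq Q fun c hc => (h1 c hc).2, innerQ_eq Q fun c hc => (h2 c hc).2,
      innerQ_eq Q fun c hc => ((h1.add h2) c hc).2]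
    simp only [map_add, mul_add, sum_add_distrib]
  map_smul' r ω := by
    obtain ⟨N, h1⟩ := exists_orderLE ω
    rw [innerQ_eq Q fun c hc => (h1 c hc).2, innerQ_eq Q fun c hc => ((h1.smul r) c hc).2]
    simp only [map_smul, mul_smul_comm, smul_sum, RingHom.id_apply]

theorem innerQLin_apply (Q : ι → Loc E) (ω : Form E) : innerQLin Q ω = innerQ Q ω := rfl

theorem IsHorizontal.innerQ_eq_zero {ω : Form E} (hω : IsHorizontal ω) (Q : ι → Loc E) :
    innerQ Q ω = 0 := by
  rw [innerQ_eq Q (N := 0) fun c _ => hω c]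
  exact sum_eq_zero fun c _ => by rw [hω c, mul_zero]

theorem innerQ_ofLoc_mul (Q : ι → Loc E) (f : Loc E) (ω : Form E) :
    innerQ Q (ofLoc f * ω) = ofLoc f * innerQ Q ω := by
  obtain ⟨N, h1, h2⟩ := exists_orderLE_two ω (ofLoc f * ω)
  rw [innerQ_eq Q fun c hc => (h1 c hc).2, innerQ_eq Q fun c hc => (h2 c hc).2, mul_sum]
  exact sum_congr rfl fun c _ => by rw [contr_ofLoc_mul, ofLoc_mul_comm]

theorem innerQ_dV_mul (Q : ι → Loc E) (i : ι) (ω : Form E) :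
    innerQ Q (dV i [] * ω) = ofLoc (Q i) * ω - dV i [] * innerQ Q ω := by
  classical
  rw [dV_eq_contact]
  obtain ⟨N, h1, h2⟩ := exists_orderLE_two ω (contact (i, ↑([] : List (Fin n))) * ω)
  rw [innerQ_eq Q fun c hc => (h1 c hc).2, innerQ_eq Q fun c hc => (h2 c hc).2, mul_sum]
  simp only [contr_contact_mul, mul_sub, sum_sub_distrib, ofLoc_mul_contact_mul]
  congr 1
  rw [sum_eq_single ((i, 0) : ι × Multiset (Fin n))]
  · simp [dLs]
  · intro c _ hc
    rw [if_neg, mul_zero]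
    intro h
    exact hc (Sum.inr_injective h).symm
  · intro h
    exact absurd (by simp [mem_labels]) h

/-- Removing an index is the transpose of adding one. The hypothesis leaves room for the added index
below the cutoff. -/
theorem sum_mul_lowered (ν : Fin n) (N : ℕ) (q F : ι × Multiset (Fin n) → Form E)
    (hF : ∀ c, N < c.2.card + 1 → F c = 0) :
    ∑ c ∈ labels n ι N, q c * lowered ν c F = ∑ c ∈ labels n ι N, q (raise ν c) * F c := by
  classical
  have h1 : ∀ c, q c * lowered ν c F
      = ∑ d ∈ labels n ι N, if raise ν d = c then q c * F d else 0 := by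
    intro c
    rw [← lowered_eq_sum ν c F (T := labels n ι N)
      (fun d hd => hF d (by rw [mem_labels] at hd; omega)), mul_sum]
    exact sum_congr rfl fun d _ => by split_ifs <;> simp
  rw [sum_congr rfl fun c _ => h1 c, sum_comm]
  refine sum_congr rfl fun d _ => ?_
  rw [sum_ite_eq]
  split_ifs with h
  · rfl
  · rw [hF d (by rw [mem_labels] at h; simpa [raise] using h), mul_zero]

theorem totalD_sum {α : Type*} (ν : Fin n) (T : Finset α) (F : α → Form E) :
    totalD ν (∑ a ∈ T, F a) = ∑ a ∈ T, totalD ν (F a) :=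
  map_sum (totalDsLin (E := E) [ν]) F T

/-- The commutator of contraction and `∂_ν` supplies the terms in which `∂_ν` differentiates the
coefficients `∂_{(μ)}Q`: this is the prolongation property of evolutionary vector fields. -/
theorem innerQ_totalD (Q : ι → Loc E) (ν : Fin n) (ω : Form E) :
    innerQ Q (totalD ν ω) = totalD ν (innerQ Q ω) := by
  obtain ⟨N, h1, h2⟩ := exists_orderLE_two ω (totalD ν ω)
  -- The cutoff is raised by one so that adding the index `ν` stays within range.
  have h1' := h1.mono (Nat.le_succ N)
  have h2' := h2.mono (Nat.le_succ N)
  rw [innerQ_eq Q fun c hc => (h1' c hc).2, innerQ_eq Q fun c hc => (h2' c hc).2, totalD_sum]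
  simp only [contr_totalD, totalD_ofLoc_mul, mul_add, sum_add_distrib]
  rw [add_comm]
  congr 1
  rw [sum_mul_lowered ν _ (fun c => ofLoc (dLs c.2 (Q c.1)))
    (fun c => contr (Sum.inr c) ω) fun c hc => (h1 c (by omega)).2]
  refine sum_congr rfl fun c _ => ?_
  simp only [raise, dLs_cons]

theorem innerQ_totalDs (Q : ι → Loc E) (μ : List (Fin n)) (ω : Form E) :
    innerQ Q (totalDs μ ω) = totalDs μ (innerQ Q ω) := by
  induction μ with
  | nil => rfl
  | cons ν μ ih => exact (innerQ_totalD Q ν _).trans (congrArg _ ih)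

/-- `(-∂)_{(ρ)}` as a linear map. -/
def negTotalDsLin (ρ : List (Fin n)) : Form E →ₗ[ℝ] Form E :=
  (-1 : ℝ) ^ ρ.length • totalDsLin ρ

theorem negTotalDsLin_apply (ρ : List (Fin n)) (ω : Form E) :
    negTotalDsLin ρ ω = negTotalDs ρ ω := rfl

theorem innerQ_negTotalDs (Q : ι → Loc E) (ρ : List (Fin n)) (ω : Form E) :
    innerQ Q (negTotalDs ρ ω) = negTotalDs ρ (innerQ Q ω) := by
  rw [negTotalDs, negTotalDs, ← innerQLin_apply, map_smul, innerQLin_apply, innerQ_totalDs]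

/-- The operator `Z ↦ ∂_{(μ)} (a (-∂)_{(ρ)} Z)`. -/
def nestedD (μ ρ : List (Fin n)) (a : Form E) : Form E →ₗ[ℝ] Form E :=
  totalDsLin μ ∘ₗ LinearMap.mulLeft ℝ a ∘ₗ negTotalDsLin ρ

theorem nestedD_apply (μ ρ : List (Fin n)) (a Z : Form E) :
    nestedD μ ρ a Z = totalDs μ (a * negTotalDs ρ Z) := rfl

/-- `i_{Q₁}` hits the outer contact form, or the inner one with a sign for passing the outer;
`i_{Q₂}` must hit the other, as `Z` contains none. -/
theorem innerQ_innerQ_nestedD (Q₁ Q₂ : ι → Loc E) (μ ρ : List (Fin n)) (i j : ι) {Z : Form E}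
    (hZ : IsHorizontal Z) :
    innerQ Q₂ (innerQ Q₁ (nestedD μ ρ (dV i []) (dV j [] * Z)))
      = nestedD μ ρ (ofLoc (Q₁ i)) (ofLoc (Q₂ j) * Z)
        - nestedD μ ρ (ofLoc (Q₂ i)) (ofLoc (Q₁ j) * Z) := by
  have h1 : ∀ (Q : ι → Loc E) (W : Form E), innerQ Q (nestedD μ ρ (dV i []) W)
      = totalDs μ (ofLoc (Q i) * negTotalDs ρ W - dV i [] * negTotalDs ρ (innerQ Q W)) := by
    intro Q W
    rw [nestedD_apply, innerQ_totalDs, innerQ_dV_mul, innerQ_negTotalDs]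
  have h2 : ∀ Q : ι → Loc E, innerQ Q (dV j [] * Z) = ofLoc (Q j) * Z := by
    intro Q
    rw [innerQ_dV_mul, hZ.innerQ_eq_zero, mul_zero, sub_zero]
  rw [h1, innerQ_totalDs, ← innerQLin_apply Q₂, map_sub, innerQLin_apply, innerQLin_apply,
    innerQ_ofLoc_mul, innerQ_dV_mul, innerQ_negTotalDs, innerQ_negTotalDs, h2, h2,
    (hZ.ofLoc_mul _).innerQ_eq_zero]
  have h3 : negTotalDs ρ (0 : Form E) = 0 := map_zero (negTotalDsLin ρ)
  rw [h3, mul_zero, sub_zero, nestedD_apply, nestedD_apply, ← totalDsLin_apply, map_sub]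
  rfl

/-! ### The currents as finite sums -/

/-- Sum over words of the nested derivatives with the binomial weights of the homotopy
operators. -/
def nestedSum (N : ℕ) (F : List (Fin n) → List (Fin n) → Form E) : Form E :=
  ∑ μ ∈ wordsLE (Fin n) N, ∑ ρ ∈ wordsLE (Fin n) N,
    ((μ.length + ρ.length + 1).choose (μ.length + 1) : ℝ) • F μ ρ

theorem nestedSum_sub (N : ℕ) (F G : List (Fin n) → List (Fin n) → Form E) :
    nestedSum N (fun μ ρ => F μ ρ - G μ ρ) = nestedSum N F - nestedSum N G := by
  simp only [nestedSum, smul_sub, sum_sub_distrib]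

theorem map_nestedSum (f : Form E →ₗ[ℝ] Form E) (N : ℕ)
    (F : List (Fin n) → List (Fin n) → Form E) :
    f (nestedSum N F) = nestedSum N fun μ ρ => f (F μ ρ) := by
  simp only [nestedSum, map_sum, map_smul]

theorem byParts_eq {P : List (Fin n) → Form E} {N : ℕ} (hP : ∀ l, N < l.length → P l = 0)
    (μ : List (Fin n)) :
    byParts P μ = ∑ ρ ∈ wordsLE (Fin n) N,
      ((μ.length + ρ.length).choose μ.length : ℝ) • negTotalDs ρ (P (μ ++ ρ)) := by
  rw [byParts, finsum_words (N := N)]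
  intro ρ hρ
  rw [hP _ (by rw [List.length_append]; omega), ← negTotalDsLin_apply, map_zero, smul_zero]

theorem byParts_eq_zero {P : List (Fin n) → Form E} {N : ℕ} (hP : ∀ l, N < l.length → P l = 0)
    {μ : List (Fin n)} (hμ : N < μ.length) : byParts P μ = 0 := by
  rw [byParts_eq hP]
  refine sum_eq_zero fun ρ _ => ?_
  rw [hP _ (by rw [List.length_append]; omega), ← negTotalDsLin_apply, map_zero, smul_zero]

/-- Common shape of the homotopy operators and of `T`: the direction `ν` counts as one more index,
which shifts both entries of the binomial coefficient by one. -/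
theorem finsum_totalDs_byParts (a : ι → Form E) (P : ι → Fin n → List (Fin n) → Form E) {N : ℕ}
    (hP : ∀ i ν l, N < l.length → P i ν l = 0)
    (hperm : ∀ i ν l l', l.Perm l' → P i ν l = P i ν l') :
    ∑ᶠ μ : List (Fin n), ∑ i, ∑ ν, totalDs μ (a i * byParts (P i ν) (μ ++ [ν]))
      = nestedSum N fun μ ρ => ∑ i, ∑ ν, nestedD μ ρ (a i) (P i ν (μ ++ ρ ++ [ν])) := by
  rw [finsum_words (N := N), nestedSum]
  · refine sum_congr rfl fun μ _ => ?_
    simp only [smul_sum]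
    symm
    rw [sum_comm]
    refine sum_congr rfl fun i _ => ?_
    rw [sum_comm]
    refine sum_congr rfl fun ν _ => ?_
    symm
    rw [byParts_eq (hP i ν), mul_sum, ← totalDsLin_apply, map_sum]
    refine sum_congr rfl fun ρ _ => ?_
    have hp : (μ ++ [ν] ++ ρ).Perm (μ ++ ρ ++ [ν]) := by
      rw [List.append_assoc, List.append_assoc]
      exact (List.perm_append_comm).append_left μ
    rw [mul_smul_comm, map_smul, hperm i ν _ _ hp, totalDsLin_apply, nestedD_apply,
      List.length_append, List.length_singleton, add_right_comm]
  · intro μ hμ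
    refine sum_eq_zero fun i _ => sum_eq_zero fun ν _ => ?_
    rw [byParts_eq_zero (hP i ν) (by rw [List.length_append]; omega), mul_zero,
      ← totalDsLin_apply, map_zero]

theorem pdSForm_perm (i : ι) {l l' : List (Fin n)} (h : l.Perm l') (ω : Form E) :
    pdSForm i l ω = pdSForm i l' ω := by
  rw [pdSForm_eq, pdSForm_eq, symWeight_perm h, Multiset.coe_eq_coe.2 h]

theorem pdS_perm (i : ι) {l l' : List (Fin n)} (h : l.Perm l') (f : Loc E) :
    pdS i l f = pdS i l' f := by
  rw [pdS, pdS, symWeight_perm h, Multiset.coe_eq_coe.2 h]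

theorem pdSForm_pddx_eq_zero {N : ℕ} {ω : Form E}
    (hω : ∀ c : ι × Multiset (Fin n), N < c.2.card → pdF c ω = 0) (i : ι) (ν : Fin n)
    {l : List (Fin n)} (hl : N < l.length) : pdSForm i l (pddx ν ω) = 0 := by
  rw [pdSForm_eq, pddx, ← contr_pdF, hω _ (by simpa using hl), map_zero, smul_zero]

/-- In top horizontal degree `p = n` the numerical prefactor of the homotopy operator equals one. -/
theorem homotopyOp_eq (a : ι → Form E) {N : ℕ} {ω : Form E}
    (hω : ∀ c : ι × Multiset (Fin n), N < c.2.card → pdF c ω = 0) :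
    homotopyOp n a ω = nestedSum N fun μ ρ => ∑ i, ∑ ν,
      nestedD μ ρ (a i) (pdSForm i (μ ++ ρ ++ [ν]) (pddx ν ω)) := by
  rw [← finsum_totalDs_byParts a (fun i ν l => pdSForm i l (pddx ν ω))
    (fun i ν l hl => pdSForm_pddx_eq_zero hω i ν hl) (fun i ν l l' h => pdSForm_perm i h _),
    homotopyOp]
  refine finsum_congr fun μ => ?_
  have h : ((μ.length : ℝ) + 1) ≠ 0 := by positivity
  rw [sub_self, zero_add, div_self h, one_smul]
  rfl

/-- The bilinear current `binom ∂_{(μ)} (Q₁ (-∂)_{(ρ)} (Q₂ ∂^S X/∂φ))`. -/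
def current (N : ℕ) (X : ι → Form E) (Q₁ Q₂ : ι → Loc E) : Form E :=
  nestedSum N fun μ ρ => ∑ i, ∑ j, ∑ ν, nestedD μ ρ (ofLoc (Q₁ i))
    (ofLoc (Q₂ j) * pdSForm i (μ ++ ρ ++ [ν]) (pddx ν (X j)))

theorem finsum_eq_current {N : ℕ} {X : ι → Form E}
    (hX : ∀ j (c : ι × Multiset (Fin n)), N < c.2.card → pdF c (X j) = 0) (Q₁ Q₂ : ι → Loc E) :
    ∑ᶠ (μ : List (Fin n)) (ρ : List (Fin n)),
      ((μ.length + ρ.length + 1).choose (μ.length + 1) : ℝ) •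
        ∑ i : ι, ∑ j : ι, ∑ ν : Fin n,
          totalDs μ (ofLoc (Q₁ i) * negTotalDs ρ
            (ofLoc (Q₂ j) * pdSForm i (μ ++ ρ ++ [ν]) (pddx ν (X j))))
      = current N X Q₁ Q₂ := by
  -- Only words with `|μ| + |ρ| + 1 ≤ N` contribute, so neither `finsum` takes its default value
  -- through infinite support.
  have h0 : ∀ μ ρ : List (Fin n), N < μ.length + ρ.length + 1 →
      ((μ.length + ρ.length + 1).choose (μ.length + 1) : ℝ) •
        ∑ i : ι, ∑ j : ι, ∑ ν : Fin n,
          totalDs μ (ofLoc (Q₁ i) * negTotalDs ρ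
            (ofLoc (Q₂ j) * pdSForm i (μ ++ ρ ++ [ν]) (pddx ν (X j)))) = 0 := by
    intro μ ρ h
    rw [sum_eq_zero, smul_zero]
    refine fun i _ => sum_eq_zero fun j _ => sum_eq_zero fun ν _ => ?_
    rw [pdSForm_pddx_eq_zero (hX j) i ν (by
      simp only [List.length_append, List.length_singleton]; omega), mul_zero, ← nestedD_apply, map_zero]
  rw [current, nestedSum, finsum_words (N := N)]
  · refine sum_congr rfl fun μ _ => ?_
    rw [finsum_words (N := N)]
    · rfl
    · exact fun ρ hρ => h0 μ ρ (by omega)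
  · intro μ hμ
    rw [finsum_congr fun ρ => h0 μ ρ (by omega), finsum_zero]

theorem pddx_dV_mul (ν : Fin n) (j : ι) (ω : Form E) :
    pddx ν (dV j [] * ω) = -(dV j [] * pddx ν ω) := by
  classical
  rw [dV_eq_contact, pddx, contr_contact_mul]
  simp

theorem pdSForm_dV_mul (i j : ι) (l : List (Fin n)) (ω : Form E) :
    pdSForm i l (dV j [] * ω) = dV j [] * pdSForm i l ω := by
  rw [dV_eq_contact, pdSForm_eq, pdSForm_eq, pdF_contact_mul, mul_smul_comm]

theorem pdSForm_ofLoc_mul (i : ι) (l : List (Fin n)) (f : Loc E) (ω : Form E) :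
    pdSForm i l (ofLoc f * ω) = ofLoc (pdS i l f) * ω + ofLoc f * pdSForm i l ω := by
  rw [pdSForm_eq, pdSForm_eq, pdF_ofLoc_mul, smul_add, mul_smul_comm, ← smul_mul_assoc,
    ← ofLoc_smul]
  rfl

theorem IsHorizontal.pdSForm {ω : Form E} (hω : IsHorizontal ω) (i : ι) (l : List (Fin n)) :
    IsHorizontal (pdSForm i l ω) := by
  rw [pdSForm_eq]
  exact (hω.pdF _).smul _

/-- The overall minus sign comes from moving `∂/∂dx^ν` past `d_Vφ^j`; it cancels the one in the
definition of the presymplectic form. -/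
theorem innerQ_innerQ_homotopyV {N : ℕ} {X : ι → Form E}
    (hX : ∀ j (c : ι × Multiset (Fin n)), N < c.2.card → pdF c (X j) = 0)
    (hor : ∀ j, IsHorizontal (X j)) (Q₁ Q₂ : ι → Loc E) :
    innerQ Q₂ (innerQ Q₁ (homotopyV n (∑ j, dV j [] * X j)))
      = -(current N X Q₁ Q₂ - current N X Q₂ Q₁) := by
  have hω : ∀ c : ι × Multiset (Fin n), N < c.2.card → pdF c (∑ j, dV j [] * X j) = 0 := by
    intro c hc
    rw [map_sum]
    refine sum_eq_zero fun j _ => ?_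
    rw [dV_eq_contact, pdF_contact_mul, hX j c hc, mul_zero]
  have h1 : ∀ (i : ι) (ν : Fin n) (l : List (Fin n)),
      pdSForm i l (pddx ν (∑ j, dV j [] * X j))
        = -∑ j, dV j [] * pdSForm i l (pddx ν (X j)) := by
    intro i ν l
    rw [map_sum, map_sum, ← sum_neg_distrib]
    refine sum_congr rfl fun j _ => ?_
    rw [pddx_dV_mul, map_neg, pdSForm_dV_mul]
  rw [homotopyV, homotopyOp_eq _ hω, ← innerQLin_apply Q₁, ← innerQLin_apply Q₂, map_nestedSum,
    map_nestedSum, current, current, ← nestedSum_sub]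
  have h2 : ∀ F : List (Fin n) → List (Fin n) → Form E,
      -nestedSum N F = nestedSum N fun μ ρ => -F μ ρ := fun F =>
    map_nestedSum (-LinearMap.id) N F
  rw [h2]
  congr 1
  funext μ ρ
  simp only [h1, map_neg, sum_neg_distrib]
  simp only [map_sum, innerQLin_apply]
  congr 1
  rw [← sum_sub_distrib]
  refine sum_congr rfl fun i _ => ?_
  rw [sum_comm, ← sum_sub_distrib]
  refine sum_congr rfl fun j _ => ?_
  rw [← sum_sub_distrib]
  refine sum_congr rfl fun ν _ => ?_
  exact innerQ_innerQ_nestedD Q₁ Q₂ μ ρ i j (((hor j).contr _).pdSForm i _)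

/-- Leibniz rule for `∂^S/∂φ` on `Q₂^j X_j`: the terms differentiating `Q₂` are those of `T`, and
the others form the current. -/
theorem homotopyQ_sub_formT {N : ℕ} {X : ι → Form E}
    (hX : ∀ j (c : ι × Multiset (Fin n)), N < c.2.card → pdF c (X j) = 0) (Q₁ Q₂ : ι → Loc E)
    (hQ : ∀ j (c : ι × Multiset (Fin n)), N < c.2.card → pdv c (Q₂ j) = 0) :
    homotopyQ n Q₁ (∑ j, ofLoc (Q₂ j) * X j) - formT Q₂ Q₁ X = current N X Q₁ Q₂ := by
  have hω : ∀ c : ι × Multiset (Fin n), N < c.2.card → pdF c (∑ j, ofLoc (Q₂ j) * X j) = 0 := by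
    intro c hc
    rw [map_sum]
    refine sum_eq_zero fun j _ => ?_
    rw [pdF_ofLoc_mul, hX j c hc, hQ j c hc, ofLoc_zero, mul_zero, zero_mul, add_zero]
  have hT := finsum_totalDs_byParts (fun i => ofLoc (Q₁ i))
    (fun i ν l => ∑ j, ofLoc (pdS i l (Q₂ j)) * pddx ν (X j)) (N := N)
    (fun i ν l hl => sum_eq_zero fun j _ => by
      have : pdS i l (Q₂ j) = 0 := by
        have := hQ j (i, ↑l) (by simpa using hl)
        rw [pdv] at this
        simp [pdS, this]
      rw [this, ofLoc_zero, zero_mul])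
    (fun i ν l l' h => sum_congr rfl fun j _ => by rw [pdS_perm i h])
  rw [homotopyQ, homotopyOp_eq _ hω, formT, hT, ← nestedSum_sub, current]
  congr 1
  funext μ ρ
  rw [← sum_sub_distrib]
  refine sum_congr rfl fun i _ => ?_
  rw [sum_comm, ← sum_sub_distrib]
  refine sum_congr rfl fun ν _ => ?_
  rw [← map_sub, ← map_sum]
  congr 1
  rw [map_sum, map_sum, ← sum_sub_distrib]
  refine sum_congr rfl fun j _ => ?_
  rw [pddx, contr_ofLoc_mul, pdSForm_ofLoc_mul, add_sub_cancel_left]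

end

section

variable {n : ℕ} {ι : Type*} {E : TopologicalSpace.Opens ((Fin n → ℝ) × (ι → ℝ))}

attribute [local instance] formRing formAddCommGroup

/-! ### Total derivatives acting on products of three factors -/

variable (E) in
/-- Formal products of two local functions and a form. -/
def Triple : Type _ := Loc E ⊗[ℝ] (Loc E ⊗[ℝ] Form E)

instance : AddCommGroup (Triple E) := inferInstanceAs (AddCommGroup (Loc E ⊗[ℝ] (Loc E ⊗[ℝ] Form E)))

instance : Module ℝ (Triple E) := inferInstanceAs (Module ℝ (Loc E ⊗[ℝ] (Loc E ⊗[ℝ] Form E)))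

/-- The formal product of two local functions and a form, linear in the form. -/
def triple (q₁ q₂ : Loc E) : Form E →ₗ[ℝ] Triple E :=
  (TensorProduct.mk ℝ (Loc E) (Loc E ⊗[ℝ] Form E) q₁) ∘ₗ (TensorProduct.mk ℝ (Loc E) (Form E) q₂)

theorem triple_ext {M : Type*} [AddCommMonoid M] [Module ℝ M] {f g : Triple E →ₗ[ℝ] M}
    (h : ∀ q₁ q₂ F, f (triple q₁ q₂ F) = g (triple q₁ q₂ F)) : f = g :=
  TensorProduct.ext (LinearMap.ext fun q₁ => TensorProduct.ext' fun q₂ F => h q₁ q₂ F)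

/-- The total derivative of the first factor. -/
def D₁ (ν : Fin n) : Module.End ℝ (Triple E) :=
  LinearMap.rTensor (Loc E ⊗[ℝ] Form E) (dL (E := E) ν)

/-- The total derivative of the second factor. -/
def D₂ (ν : Fin n) : Module.End ℝ (Triple E) :=
  LinearMap.lTensor (Loc E) (LinearMap.rTensor (Form E) (dL (E := E) ν))

/-- The total derivative of the third factor. -/
def D₃ (ν : Fin n) : Module.End ℝ (Triple E) :=
  LinearMap.lTensor (Loc E) (LinearMap.lTensor (Loc E) (DH (E := E) ν))

theorem D₁_triple (ν : Fin n) (q₁ q₂ : Loc E) (F : Form E) :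
    D₁ ν (triple q₁ q₂ F) = triple (dL ν q₁) q₂ F := rfl

theorem D₂_triple (ν : Fin n) (q₁ q₂ : Loc E) (F : Form E) :
    D₂ ν (triple q₁ q₂ F) = triple q₁ (dL ν q₂) F := rfl

theorem D₃_triple (ν : Fin n) (q₁ q₂ : Loc E) (F : Form E) :
    D₃ ν (triple q₁ q₂ F) = triple q₁ q₂ (DH ν F) := rfl

variable (E) in
/-- The derivatives of the three factors. -/
def derivOps : Set (Module.End ℝ (Triple E)) := Set.range D₁ ∪ Set.range D₂ ∪ Set.range D₃

/-- Operators on different factors act in different tensor slots; on one factor total derivatives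
commute. Hence the generated algebra is commutative and can serve as a coefficient ring for symbols.
-/
theorem derivOps_comm : ∀ a ∈ derivOps E, ∀ b ∈ derivOps E, a * b = b * a := by
  rintro a ((⟨μ, rfl⟩ | ⟨μ, rfl⟩) | ⟨μ, rfl⟩) b ((⟨ν, rfl⟩ | ⟨ν, rfl⟩) | ⟨ν, rfl⟩) <;>
  refine triple_ext fun q₁ q₂ F => ?_ <;>
  simp only [Module.End.mul_apply, D₁_triple, D₂_triple, D₃_triple, dL_comm μ ν, DH_comm μ ν]

variable (E) in
/-- The commutative algebra generated by the derivatives of the three factors. -/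
def SymbolRing : Type _ := Algebra.adjoin ℝ (derivOps E)

instance : Ring (SymbolRing E) := inferInstanceAs (Ring (Algebra.adjoin ℝ (derivOps E)))

instance : CommRing (SymbolRing E) :=
  { (inferInstance : Ring (SymbolRing E)) with
    mul_comm := (Algebra.isMulCommutative_adjoin ℝ derivOps_comm).is_comm.comm }

instance : Algebra ℝ (SymbolRing E) :=
  inferInstanceAs (Algebra ℝ (Algebra.adjoin ℝ (derivOps E)))

variable (E) in
/-- Symbols as operators on triple products. -/
def symbolHom : SymbolRing E →+* Module.End ℝ (Triple E) where
  toFun x := x.1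
  map_one' := rfl
  map_mul' _ _ := rfl
  map_zero' := rfl
  map_add' _ _ := rfl

instance : Module (SymbolRing E) (Triple E) := Module.compHom (Triple E) (symbolHom E)

instance : IsScalarTower ℝ (SymbolRing E) (Triple E) := ⟨fun _ _ _ => rfl⟩

/-- The derivative of the first factor as a symbol. -/
def sym₁ (ν : Fin n) : SymbolRing E :=
  ⟨D₁ ν, Algebra.subset_adjoin (Or.inl (Or.inl ⟨ν, rfl⟩))⟩

/-- The derivative of the second factor as a symbol. -/
def sym₂ (ν : Fin n) : SymbolRing E :=
  ⟨D₂ ν, Algebra.subset_adjoin (Or.inl (Or.inr ⟨ν, rfl⟩))⟩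

/-- The derivative of the third factor as a symbol. -/
def sym₃ (ν : Fin n) : SymbolRing E :=
  ⟨D₃ ν, Algebra.subset_adjoin (Or.inr ⟨ν, rfl⟩)⟩

/-- The symbol of the total derivative of a product. -/
def symD (ν : Fin n) : SymbolRing E := sym₁ ν + sym₂ ν + sym₃ ν

/-- Local functions acting on forms. -/
def mulLoc : Loc E →ₗ[ℝ] Form E →ₗ[ℝ] Form E :=
  (LinearMap.mul ℝ (Form E)) ∘ₗ
    { toFun := ofLoc, map_add' := ofLoc_add, map_smul' := ofLoc_smul }

theorem mulLoc_apply (q : Loc E) (F : Form E) : mulLoc q F = ofLoc q * F := rfl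

/-- The product of the last two factors. -/
def mul₂₃ : Triple E →ₗ[ℝ] Loc E ⊗[ℝ] Form E :=
  LinearMap.lTensor (Loc E) (TensorProduct.lift (mulLoc (E := E)))

/-- The product of the first and the last factor. -/
def mul₁₃ : Triple E →ₗ[ℝ] Loc E ⊗[ℝ] Form E :=
  LinearMap.lTensor (Loc E) (TensorProduct.lift (mulLoc (E := E))) ∘ₗ
    (TensorProduct.leftComm ℝ (Loc E) (Loc E) (Form E)).toLinearMap

/-- The product of the three factors. -/
def mul₁₂₃ : Triple E →ₗ[ℝ] Form E := TensorProduct.lift (mulLoc (E := E)) ∘ₗ mul₂₃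

theorem mul₂₃_triple (q₁ q₂ : Loc E) (F : Form E) :
    mul₂₃ (triple q₁ q₂ F) = q₁ ⊗ₜ[ℝ] (ofLoc q₂ * F) := rfl

theorem mul₁₃_triple (q₁ q₂ : Loc E) (F : Form E) :
    mul₁₃ (triple q₁ q₂ F) = q₂ ⊗ₜ[ℝ] (ofLoc q₁ * F) := rfl

theorem mul₁₂₃_triple (q₁ q₂ : Loc E) (F : Form E) :
    mul₁₂₃ (triple q₁ q₂ F) = ofLoc q₁ * (ofLoc q₂ * F) := rfl

/-- The Leibniz rule: `a + b + c` becomes the total derivative once the factors are multiplied. -/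
theorem mul₁₂₃_symD_smul (ν : Fin n) (v : Triple E) :
    mul₁₂₃ ((symD ν : SymbolRing E) • v) = DH ν (mul₁₂₃ v) := by
  have h : mul₁₂₃ ∘ₗ (D₁ ν + D₂ ν + D₃ ν) = DH ν ∘ₗ mul₁₂₃ (E := E) := by
    refine triple_ext fun q₁ q₂ F => ?_
    simp only [LinearMap.comp_apply, LinearMap.add_apply, map_add, D₁_triple, D₂_triple, D₃_triple,
      mul₁₂₃_triple, DH_ofLoc_mul, mul_add]
    abel
  exact LinearMap.congr_fun h v

theorem mul₁₂₃_symD_prod_smul (μ : List (Fin n)) (v : Triple E) :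
    mul₁₂₃ ((μ.map (symD (E := E))).prod • v) = DHs μ (mul₁₂₃ v) := by
  induction μ with
  | nil => rw [List.map_nil, List.prod_nil, one_smul, DHs_nil]
  | cons ν μ ih => rw [List.map_cons, List.prod_cons, mul_smul, mul₁₂₃_symD_smul, ih, DHs_cons]

/-- Signed iterated total derivatives of the coefficients. -/
def negDHs (ρ : List (Fin n)) : Form E →ₗ[ℝ] Form E := (-1 : ℝ) ^ ρ.length • DHs ρ

theorem negDHs_cons (ν : Fin n) (ρ : List (Fin n)) (F : Form E) :
    negDHs (ν :: ρ) F = -DH ν (negDHs ρ F) := by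
  simp only [negDHs, LinearMap.smul_apply, DHs_cons, List.length_cons, pow_succ, map_smul]
  simp

theorem negDHs_nil (F : Form E) : negDHs [] F = F := by simp [negDHs, DHs_nil]

/-- The partial product `κ` intertwines the symbol `e l` with `-∂_l` on the merged pair and leaves
the remaining factor alone. It serves for both ways of pairing a function with the form. -/
theorem mul_prod_smul (e : Fin n → SymbolRing E) (κ : Triple E →ₗ[ℝ] Loc E ⊗[ℝ] Form E)
    (hκ : ∀ l v, κ (e l • v) = -LinearMap.lTensor (Loc E) (DH l) (κ v)) (ρ : List (Fin n))
    (v : Triple E) {q : Loc E} {G : Form E} (hv : κ v = q ⊗ₜ[ℝ] G) :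
    κ ((ρ.map e).prod • v) = q ⊗ₜ[ℝ] negDHs ρ G := by
  induction ρ with
  | nil => rw [List.map_nil, List.prod_nil, one_smul, negDHs_nil, hv]
  | cons ν ρ ih =>
    rw [List.map_cons, List.prod_cons, mul_smul, hκ, ih, negDHs_cons, LinearMap.lTensor_tmul,
      TensorProduct.tmul_neg]

theorem mul₂₃_smul (l : Fin n) (v : Triple E) :
    mul₂₃ ((-(sym₂ l + sym₃ l) : SymbolRing E) • v)
      = -LinearMap.lTensor (Loc E) (DH l) (mul₂₃ v) := by
  have h : mul₂₃ ∘ₗ (D₂ l + D₃ l) = LinearMap.lTensor (Loc E) (DH l) ∘ₗ mul₂₃ (E := E) := by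
    refine triple_ext fun q₁ q₂ F => ?_
    simp only [LinearMap.comp_apply, LinearMap.add_apply, map_add, D₂_triple, D₃_triple,
      mul₂₃_triple, LinearMap.lTensor_tmul, DH_ofLoc_mul, TensorProduct.tmul_add]
  rw [neg_smul, map_neg]
  exact congrArg _ (LinearMap.congr_fun h v)

theorem mul₁₃_smul (l : Fin n) (v : Triple E) :
    mul₁₃ ((-(sym₁ l + sym₃ l) : SymbolRing E) • v)
      = -LinearMap.lTensor (Loc E) (DH l) (mul₁₃ v) := by
  have h : mul₁₃ ∘ₗ (D₁ l + D₃ l) = LinearMap.lTensor (Loc E) (DH l) ∘ₗ mul₁₃ (E := E) := by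
    refine triple_ext fun q₁ q₂ F => ?_
    simp only [LinearMap.comp_apply, LinearMap.add_apply, map_add, D₁_triple, D₃_triple,
      mul₁₃_triple, LinearMap.lTensor_tmul, DH_ofLoc_mul, TensorProduct.tmul_add]
  rw [neg_smul, map_neg]
  exact congrArg _ (LinearMap.congr_fun h v)

theorem mul₁₂₃_eq_mul₁₃ (v : Triple E) :
    mul₁₂₃ v = TensorProduct.lift (mulLoc (E := E)) (mul₁₃ v) := by
  have h : mul₁₂₃ = TensorProduct.lift (mulLoc (E := E)) ∘ₗ mul₁₃ := by
    refine triple_ext fun q₁ q₂ F => ?_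
    rw [mul₁₂₃_triple, LinearMap.comp_apply, mul₁₃_triple, TensorProduct.lift.tmul, mulLoc_apply,
      ofLoc_mul_comm]
  exact LinearMap.congr_fun h v

variable [Fintype ι]

theorem IsHorizontal.negTotalDs_eq {F : Form E} (hF : IsHorizontal F) (ρ : List (Fin n)) :
    negTotalDs ρ F = negDHs ρ F := by
  rw [negTotalDs, hF.totalDs_eq]; rfl

theorem IsHorizontal.negDHs {F : Form E} (hF : IsHorizontal F) (ρ : List (Fin n)) :
    IsHorizontal (negDHs ρ F) := (hF.DHs ρ).smul _

theorem IsHorizontal.nestedD_eq {F : Form E} (hF : IsHorizontal F) (μ ρ : List (Fin n))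
    (q : Loc E) : nestedD μ ρ (ofLoc q) F = VarBicomplex.DHs μ (ofLoc q * VarBicomplex.negDHs ρ F) := by
  rw [nestedD_apply, hF.negTotalDs_eq, ((hF.negDHs ρ).ofLoc_mul q).totalDs_eq]

theorem nestedD_eq_mul₁₂₃ (μ ρ : List (Fin n)) (q₁ q₂ : Loc E) {F : Form E}
    (hF : IsHorizontal F) :
    nestedD μ ρ (ofLoc q₁) (ofLoc q₂ * F) = mul₁₂₃ (((μ.map (symD (E := E))).prod *
      (ρ.map fun l => -(sym₂ l + sym₃ l)).prod) • triple q₁ q₂ F) := by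
  rw [(hF.ofLoc_mul q₂).nestedD_eq, mul_smul, mul₁₂₃_symD_prod_smul]
  congr 1
  rw [mul₁₂₃, LinearMap.comp_apply,
    mul_prod_smul _ _ mul₂₃_smul ρ _ (mul₂₃_triple q₁ q₂ F), TensorProduct.lift.tmul, mulLoc_apply]

/-- With the roles of the functions exchanged, the inner derivatives act on `q₁ F`. Keeping the same
element `triple q₁ q₂ F` as in `nestedD_eq_mul₁₂₃` reduces the comparison of the two currents to one
of symbols. -/
theorem nestedD_swap_eq_mul₁₂₃ (μ ρ : List (Fin n)) (q₁ q₂ : Loc E) {F : Form E}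
    (hF : IsHorizontal F) :
    nestedD μ ρ (ofLoc q₂) (ofLoc q₁ * F) = mul₁₂₃ (((μ.map (symD (E := E))).prod *
      (ρ.map fun l => -(sym₁ l + sym₃ l)).prod) • triple q₁ q₂ F) := by
  rw [(hF.ofLoc_mul q₁).nestedD_eq, mul_smul, mul₁₂₃_symD_prod_smul]
  congr 1
  rw [mul₁₂₃_eq_mul₁₃,
    mul_prod_smul _ _ mul₁₃_smul ρ _ (mul₁₃_triple q₁ q₂ F), TensorProduct.lift.tmul, mulLoc_apply]

end

section

variable {n : ℕ} {ι : Type*} {E : TopologicalSpace.Opens ((Fin n → ℝ) × (ι → ℝ))}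

attribute [local instance] formRing formAddCommGroup

/-! ### Antisymmetry of the current of an Euler-Lagrange derivative -/

/-- Bound on the order of the coefficients of a form. -/
def CoeffOrderLE (N : ℕ) (F : Form E) : Prop :=
  ∀ c : ι × Multiset (Fin n), N < c.2.card → pdF c F = 0

theorem CoeffOrderLE.mono {N M : ℕ} (h : N ≤ M) {F : Form E} (hF : CoeffOrderLE N F) :
    CoeffOrderLE M F := fun c hc => hF c (lt_of_le_of_lt h hc)

theorem CoeffOrderLE.DH {N : ℕ} {F : Form E} (hF : CoeffOrderLE N F) (l : Fin n) :
    CoeffOrderLE (N + 1) (DH l F) := fun c hc => by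
  rw [pdF_DH, hF c (by omega), map_zero, zero_add, lowered]
  split_ifs with h
  · refine hF _ ?_
    have h2 := Multiset.card_erase_add_one h
    change N < (c.2.erase l).card
    omega
  · rfl

theorem CoeffOrderLE.negDHs {N : ℕ} {F : Form E} (hF : CoeffOrderLE N F) (ρ : List (Fin n)) :
    CoeffOrderLE (N + ρ.length) (negDHs ρ F) := by
  induction ρ with
  | nil => rw [negDHs_nil]; exact hF
  | cons l ρ ih =>
    intro c hc
    rw [negDHs_cons, map_neg, ih.DH l c hc, neg_zero]

theorem contr_negDHs (c : Coord n ι) (ρ : List (Fin n)) (F : Form E) :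
    contr c (negDHs ρ F) = negDHs ρ (contr c F) := by
  induction ρ with
  | nil => rw [negDHs_nil, negDHs_nil]
  | cons l ρ ih => rw [negDHs_cons, negDHs_cons, map_neg, contr_DH, ih]

/-! ### Symbols of linearized differential operators -/

section Symbols

variable {S : Type*} [CommRing S] [Algebra ℝ S] {V : Type*} [AddCommGroup V] [Module S V]
  [Module ℝ V] [IsScalarTower ℝ S V]

/-- The pairing of a symbol with the derivatives of a form. -/
def symbolSum (N : ℕ) (K : MvPolynomial (Fin n) S →ₗ[S] S) (τ : Form E →ₗ[ℝ] V) (i : ι)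
    (p : MvPolynomial (Fin n) S) (F : Form E) : V :=
  ∑ s ∈ msetsLE (Fin n) N, K (p * mono S s) • τ (pdF (i, s) F)

/-- In `∂/∂φ_s ∘ ∂_l`, the derivative either still acts on the coefficient, giving `c_l`, or absorbs
one index `l` of `s`, giving `u_l`. The order bound keeps the shifted index below the cutoff. -/
theorem symbolSum_DH {N : ℕ} (K : MvPolynomial (Fin n) S →ₗ[S] S) {τ : Form E →ₗ[ℝ] V}
    {c : Fin n → S} (hτ : ∀ l F, τ (DH l F) = c l • τ F) (i : ι) (p : MvPolynomial (Fin n) S)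
    (l : Fin n) {F : Form E} (hF : ∀ s : ι × Multiset (Fin n), N < s.2.card + 1 → pdF s F = 0) :
    symbolSum N K τ i p (DH l F)
      = symbolSum N K τ i (p * (MvPolynomial.C (c l) + MvPolynomial.X l)) F := by
  simp only [symbolSum, pdF_DH, map_add, smul_add, sum_add_distrib, hτ]
  rw [sum_msetsLE_cons l N (fun s => K (p * mono S s) • τ (lowered l (i, s) fun d => pdF d F)),
    ← sum_add_distrib]
  · refine sum_congr rfl fun s _ => ?_
    have h : lowered l (i, l ::ₘ s) (fun d => pdF d F) = pdF (i, s) F :=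
      lowered_raise l (i, s) fun d => pdF d F
    rw [h, smul_smul, ← add_smul]
    congr 1
    rw [mono_cons, mul_add, add_mul, map_add, mul_comm (K _) (c l), ← smul_eq_mul, ← map_smul,
      MvPolynomial.smul_eq_C_mul]
    congr 2 <;> ring
  · intro s hs
    rw [lowered, if_neg hs, map_zero, smul_zero]
  · intro s hs
    rw [lowered]
    split_ifs with h
    · rw [hF, map_zero, smul_zero]
      have h2 := Multiset.card_erase_add_one h
      change N < (s.erase l).card + 1
      change (s.erase l).card + 1 = s.card at h2
      omega
    · rw [map_zero, smul_zero]

theorem adjSymbol_adjSymbol (c : Fin n → S) (p : MvPolynomial (Fin n) S) :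
    adjSymbol c (adjSymbol c p) = p := by
  induction p using MvPolynomial.induction_on with
  | C r => simp [adjSymbol, MvPolynomial.algebraMap_eq]
  | add p q hp hq => rw [map_add, map_add, hp, hq]
  | mul_X p l hp =>
    rw [map_mul, map_mul, hp]
    simp [adjSymbol, MvPolynomial.algebraMap_eq]

/-- Each `-∂_l` multiplies the symbol by `-(c_l + u_l)`, which is the adjoint of `u_l`. -/
theorem symbolSum_negDHs {N M : ℕ} (K : MvPolynomial (Fin n) S →ₗ[S] S) {τ : Form E →ₗ[ℝ] V}
    {c : Fin n → S} (hτ : ∀ l F, τ (DH l F) = c l • τ F) (i : ι) (p : MvPolynomial (Fin n) S)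
    (ρ : List (Fin n)) {F : Form E} (hF : CoeffOrderLE M F) (hN : M + ρ.length ≤ N) :
    symbolSum N K τ i p (negDHs ρ F) = symbolSum N K τ i (p * adjSymbol c (mono S ρ)) F := by
  induction ρ generalizing p with
  | nil => rw [negDHs_nil]; simp [mono]
  | cons l ρ ih =>
    rw [List.length_cons] at hN
    have h : symbolSum N K τ i p (negDHs (l :: ρ) F)
        = -symbolSum N K τ i p (DH l (negDHs ρ F)) := by
      rw [negDHs_cons]
      simp only [symbolSum, map_neg, smul_neg, sum_neg_distrib]
    have h2 : ∀ q : MvPolynomial (Fin n) S,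
        -symbolSum N K τ i q (negDHs ρ F) = symbolSum N K τ i (-q) (negDHs ρ F) := by
      intro q
      simp only [symbolSum, neg_mul, map_neg, neg_smul, sum_neg_distrib]
    rw [h, symbolSum_DH K hτ i p l (fun s hs => hF.negDHs ρ s (by omega)), h2, ih _ (by omega),
      ← Multiset.cons_coe, mono_cons, map_mul]
    congr 1
    simp only [adjSymbol, MvPolynomial.aeval_X]
    ring

end Symbols

variable [Fintype ι]

theorem eulerLagrange_eq {N : ℕ} {ω : Form E} (hω : CoeffOrderLE N ω) (hor : IsHorizontal ω)
    (i : ι) : eulerLagrange i ω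
      = ∑ ρ ∈ wordsLE (Fin n) N, symWeight ρ • negDHs ρ (pdF (i, ↑ρ) ω) := by
  rw [eulerLagrange, lieEuler, byParts_eq (N := N)]
  · refine sum_congr rfl fun ρ _ => ?_
    rw [List.nil_append, (hor.pdSForm i ρ).negTotalDs_eq, pdSForm_eq, map_smul]
    simp
  · intro l hl
    rw [pdSForm_eq, hω _ (by simpa using hl), smul_zero]

theorem isHorizontal_eulerLagrange {ω : Form E} (hor : IsHorizontal ω) (i : ι) :
    IsHorizontal (eulerLagrange i ω) := by
  obtain ⟨N, hN⟩ := exists_orderLE ω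
  rw [eulerLagrange_eq (fun c hc => (hN c hc).1) hor]
  exact IsHorizontal.sum fun ρ _ => ((hor.pdF _).negDHs ρ).smul _

/-- Up to `N` total derivatives are applied to coefficients of order at most `N`, each raising the
order by at most one; hence the cutoff `N + N` for the currents. -/
theorem coeffOrderLE_eulerLagrange {N : ℕ} {ω : Form E} (hω : CoeffOrderLE N ω)
    (hor : IsHorizontal ω) (i : ι) : CoeffOrderLE (N + N) (eulerLagrange i ω) := by
  intro c hc
  rw [eulerLagrange_eq hω hor, map_sum]
  refine sum_eq_zero fun ρ hρ => ?_
  rw [mem_wordsLE] at hρ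
  have h : CoeffOrderLE N (pdF (i, (ρ : Multiset (Fin n))) ω) := fun d hd => by
    rw [pdF_comm, hω d hd, map_zero]
  rw [map_smul, h.negDHs ρ c (by omega), smul_zero]

/-- The part of the current with given fields and direction, expressed by symbols. -/
theorem nestedSum_eulerLagrange {N M : ℕ} (hNM : N + N ≤ M) {ω : Form E} (hω : CoeffOrderLE N ω)
    (hor : IsHorizontal ω) {q q' : Loc E} {e : Fin n → SymbolRing E}
    {τ : Form E →ₗ[ℝ] Triple E} (hτ : ∀ l F, τ (DH l F) = (sym₃ l : SymbolRing E) • τ F)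
    (hnest : ∀ μ ρ (F : Form E), IsHorizontal F → nestedD μ ρ (ofLoc q) (ofLoc q' * F)
      = mul₁₂₃ (((μ.map (symD (E := E))).prod * (ρ.map e).prod) • τ F)) (i j : ι) (ν : Fin n) :
    nestedSum M (fun μ ρ => nestedD μ ρ (ofLoc q)
        (ofLoc q' * pdSForm i (μ ++ ρ ++ [ν]) (pddx ν (eulerLagrange j ω))))
      = mul₁₂₃ (∑ t ∈ msetsLE (Fin n) N, ∑ s ∈ msetsLE (Fin n) N,
        avgSymbol symD e ν (adjSymbol sym₃ (mono _ t) * mono _ s) •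
          τ (pdF (i, s) (pdF (j, t) (pddx ν ω)))) := by
  set Y := pddx ν (eulerLagrange j ω) with hY
  have hYhor : IsHorizontal Y := (isHorizontal_eulerLagrange hor j).contr _
  have hYord : CoeffOrderLE M Y := fun c hc => by
    rw [hY, pddx, ← contr_pdF, coeffOrderLE_eulerLagrange hω hor j c (by omega), map_zero]
  have hZ : CoeffOrderLE N (pddx ν ω) := fun c hc => by
    rw [pddx, ← contr_pdF, hω c hc, map_zero]
  have hYeq : Y = ∑ ρ ∈ wordsLE (Fin n) N,
      symWeight ρ • negDHs ρ (pdF (j, ↑ρ) (pddx ν ω)) := by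
    rw [hY, eulerLagrange_eq hω hor, map_sum]
    refine sum_congr rfl fun ρ _ => ?_
    rw [map_smul, pddx, contr_negDHs, contr_pdF]
  have h1 : nestedSum M (fun μ ρ => nestedD μ ρ (ofLoc q)
        (ofLoc q' * pdSForm i (μ ++ ρ ++ [ν]) Y))
      = mul₁₂₃ (symbolSum M (avgSymbol symD e ν) τ i 1 Y) := by
    have h2 := sum_words_choose_eq_avgSymbol (symD (E := E)) e ν M (fun s => τ (pdF (i, s) Y))
      (fun s hs => by rw [hYord (i, s) hs, map_zero])
    simp only [symbolSum, one_mul]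
    rw [← h2, nestedSum, map_sum]
    refine sum_congr rfl fun μ _ => ?_
    rw [map_sum]
    refine sum_congr rfl fun ρ _ => ?_
    rw [hnest _ _ _ (hYhor.pdSForm i _), ← map_smul mul₁₂₃]
    congr 1
    rw [pdSForm_eq, map_smul τ, smul_comm _ (symWeight _), smul_smul]
  -- Linearizing `Σ (-∂)_{(t)} ∂ω/∂φ^j_t` gives second derivatives of `ω` paired with `adj(u^t)
  -- u^s`.
  have h3 : symbolSum M (avgSymbol symD e ν) τ i 1 Y = ∑ t ∈ msetsLE (Fin n) N,
      symbolSum M (avgSymbol symD e ν) τ i (adjSymbol sym₃ (mono _ t))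
        (pdF (j, t) (pddx ν ω)) := by
    rw [← sum_wordsLE_symWeight N fun t => symbolSum M (avgSymbol symD e ν) τ i
      (adjSymbol sym₃ (mono _ t)) (pdF (j, t) (pddx ν ω)), hYeq]
    have h4 : ∀ ρ ∈ wordsLE (Fin n) N,
        symbolSum M (avgSymbol symD e ν) τ i (adjSymbol sym₃ (mono _ (ρ : Multiset (Fin n))))
          (pdF (j, ↑ρ) (pddx ν ω))
        = symbolSum M (avgSymbol symD e ν) τ i 1 (negDHs ρ (pdF (j, ↑ρ) (pddx ν ω))) := by
      intro ρ hρ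
      rw [mem_wordsLE] at hρ
      rw [symbolSum_negDHs (M := N) _ hτ i 1 ρ (fun d hd => by rw [pdF_comm, hZ d hd, map_zero])
        (by omega), one_mul]
    rw [sum_congr rfl fun ρ hρ => congrArg (symWeight ρ • ·) (h4 ρ hρ)]
    simp only [symbolSum, map_sum, smul_sum]
    rw [sum_comm]
    refine sum_congr rfl fun ρ _ => sum_congr rfl fun s _ => ?_
    rw [map_smul, map_smul, smul_comm]
  rw [h1, h3]
  congr 1
  refine sum_congr rfl fun t _ => ?_
  symm
  -- Second derivatives of `ω` vanish for `s` beyond order `N`. Cutting the range of `s` down from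
  -- `M` makes the double sum symmetric in `s` and `t`.
  refine sum_subset (fun s hs => ?_) fun s _ hs => ?_
  · rw [mem_msetsLE] at hs ⊢
    omega
  · rw [pdF_comm, hZ (i, s) (by rw [mem_msetsLE] at hs; simp only; omega), map_zero, map_zero,
      smul_zero]

theorem nestedSum_sum {α : Type*} (N : ℕ) (T : Finset α)
    (F : α → List (Fin n) → List (Fin n) → Form E) :
    nestedSum N (fun μ ρ => ∑ a ∈ T, F a μ ρ) = ∑ a ∈ T, nestedSum N (F a) := by
  simp only [nestedSum, smul_sum]
  exact (sum_congr rfl fun μ _ => sum_comm).trans sum_comm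

theorem current_eq_sum (N : ℕ) (X : ι → Form E) (Q₁ Q₂ : ι → Loc E) :
    current N X Q₁ Q₂ = ∑ i, ∑ j, ∑ ν, nestedSum N fun μ ρ => nestedD μ ρ (ofLoc (Q₁ i))
      (ofLoc (Q₂ j) * pdSForm i (μ ++ ρ ++ [ν]) (pddx ν (X j))) := by
  simp only [current, nestedSum_sum]

/-- The current of an Euler-Lagrange derivative is antisymmetric. -/
theorem current_eulerLagrange_antisymm {N M : ℕ} (hNM : N + N ≤ M) {ω : Form E}
    (hω : CoeffOrderLE N ω) (hor : IsHorizontal ω) (Q₁ Q₂ : ι → Loc E) :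
    current M (fun j => eulerLagrange j ω) Q₂ Q₁
      = -current M (fun j => eulerLagrange j ω) Q₁ Q₂ := by
  rw [current_eq_sum, current_eq_sum, sum_comm, ← sum_neg_distrib]
  refine sum_congr rfl fun i _ => ?_
  rw [← sum_neg_distrib]
  refine sum_congr rfl fun j _ => ?_
  rw [← sum_neg_distrib]
  refine sum_congr rfl fun ν _ => ?_
  -- Both currents are written over the same triple; with `i`, `j` and `s`, `t` exchanged, they
  -- share their second derivatives of `ω` and differ only in the symbol.
  rw [nestedSum_eulerLagrange hNM hω hor (τ := triple (Q₁ i) (Q₂ j)) (fun l F => rfl)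
      (fun μ ρ F hF => nestedD_eq_mul₁₂₃ μ ρ (Q₁ i) (Q₂ j) hF) i j ν,
    nestedSum_eulerLagrange hNM hω hor (τ := triple (Q₁ i) (Q₂ j)) (fun l F => rfl)
      (fun μ ρ F hF => nestedD_swap_eq_mul₁₂₃ μ ρ (Q₁ i) (Q₂ j) hF) j i ν, ← map_neg, sum_comm,
    ← sum_neg_distrib]
  congr 1
  refine sum_congr rfl fun t _ => ?_
  rw [← sum_neg_distrib]
  refine sum_congr rfl fun s _ => ?_
  rw [pdF_comm (i, s), ← neg_smul]
  congr 1
  -- The adjoint is an involution, so `adj(adj(u^t) u^s) = adj(u^s) u^t`, the symbol of the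
  -- exchanged current.
  have h := avgSymbol_adjSymbol (sym₁ (E := E)) sym₂ sym₃ ν
    (adjSymbol sym₃ (mono _ t) * mono _ s)
  rw [map_mul, adjSymbol_adjSymbol, mul_comm] at h
  exact h

theorem exists_common_bound (ω : Form E) (Q : ι → Loc E) :
    ∃ N, CoeffOrderLE N ω ∧ ∀ j (c : ι × Multiset (Fin n)), N < c.2.card → pdv c (Q j) = 0 := by
  obtain ⟨N, hN⟩ := exists_orderLE ω
  choose B hB using fun j => exists_pdv_bound (Q j)
  refine ⟨N + ∑ j, B j, fun c hc => (hN c (by omega)).1, fun j c hc => hB j c ?_⟩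
  have := single_le_sum (f := B) (fun _ _ => Nat.zero_le _) (mem_univ j)
  omega

/-- The contraction is half of `J(Q₁, Q₂) - J(Q₂, Q₁)`, and antisymmetry doubles the first term. -/
theorem presymplecticEval_eq_current {N M : ℕ} (hNM : N + N ≤ M) {ω : Form E}
    (hω : CoeffOrderLE N ω) (hor : IsHorizontal ω) (Q₁ Q₂ : ι → Loc E) :
    presymplecticEval ω Q₁ Q₂ = current M (fun j => eulerLagrange j ω) Q₁ Q₂ := by
  have hX : ∀ j, CoeffOrderLE M (eulerLagrange j ω) := fun j =>
    (coeffOrderLE_eulerLagrange hω hor j).mono hNM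
  rw [presymplecticEval, presymplectic, ← innerQLin_apply Q₁, ← innerQLin_apply Q₂, map_neg,
    map_neg, map_smul, map_smul, innerQLin_apply, innerQLin_apply,
    innerQ_innerQ_homotopyV hX (isHorizontal_eulerLagrange hor) Q₁ Q₂,
    current_eulerLagrange_antisymm hNM hω hor Q₁ Q₂, sub_neg_eq_add, smul_neg, neg_neg,
    ← two_smul ℝ, smul_smul]
  norm_num

end

end VarBicomplex

end

/-! ### The proposition -/

open VarBicomplex in
theorem mainTheorem10 {n : ℕ} {ι : Type*} [Fintype ι]
    (E : TopologicalSpace.Opens ((Fin n → ℝ) × (ι → ℝ)))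
    (ω : Form E) (hω : ω ∈ formsOfType E n 0) (Q₁ Q₂ : ι → Loc E) :
    presymplecticEval ω Q₁ Q₂ =
        homotopyQ n Q₁ (∑ i : ι, ofLoc (Q₂ i) * eulerLagrange i ω)
          - formT Q₂ Q₁ (fun j => eulerLagrange j ω) ∧
    presymplecticEval ω Q₁ Q₂ =
        ∑ᶠ (μ : List (Fin n)) (ρ : List (Fin n)),
          ((μ.length + ρ.length + 1).choose (μ.length + 1) : ℝ) •
            ∑ i : ι, ∑ j : ι, ∑ ν : Fin n,
              totalDs μ (ofLoc (Q₁ i) * negTotalDs ρ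
                (ofLoc (Q₂ j) * pdSForm i (μ ++ ρ ++ [ν]) (pddx ν (eulerLagrange j ω)))) := by
  have hor := isHorizontal_of_mem_formsOfType hω
  obtain ⟨N, hN, hQ⟩ := exists_common_bound ω Q₂
  have hX : ∀ j, CoeffOrderLE (N + N) (eulerLagrange j ω) := coeffOrderLE_eulerLagrange hN hor
  -- The cutoff `N + N` bounds the order of the Euler-Lagrange derivatives and also that of `Q₂`,
  -- which the homotopy operator and `T` differentiate.
  have h := presymplecticEval_eq_current le_rfl hN hor Q₁ Q₂
  exact ⟨h.trans (homotopyQ_sub_formT hX Q₁ Q₂ fun j c hc => hQ j c (by omega)).symm,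
    h.trans (finsum_eq_current hX Q₁ Q₂).symm⟩
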